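/- **Theorem 2.5.** Let $N\ge 1$, $1<p<\infty$, and let $p^*=\frac{pN}{N-p}$ if $p<N$, while $p^*\in(p,\infty)$ is arbitrary but fixed if $p\ge N$. Let $\Omega\subset\mathbb R^N$ be open (possibly unbounded) such that $W^{1,p}(\Omega)$ is continuously embedded in $L^{p^*}(\Omega)$. Let $j:\Omega\times\mathbb R\times\mathbb R^N\to\mathbb R$ be a Carathéodory function, i.e. $j(\cdot,\mu,\xi)$ is measurable for every $(\mu,\xi)$ and $j(x,\cdot,\cdot)$ is continuous for a.e. $x$. Suppose that there are a constant $C>0$ and a function $h\in L^1(\Omega)$ such that for a.e. $x\in\Omega$ and every $\mu\in\mathbb R$, $\xi\in\mathbb R^N$, $$j(x,\mu,\xi)\ \ge\ -C\big(|\xi|^p+|\mu|^{p^*}+|\mu|^p\big)-|h(x)|,$$ and that $j(x,\mu,\cdot)$ is strictly convex for a.e. $x\in\Omega$ and every $\mu\in\mathbb R$. Then the functional $$J(v):=\int_\Omega j(x,v,Dv)\,dx\in\mathbb R\cup\{+\infty\},\qquad v\in W^{1,p}(\Omega),$$ is well defined. For $1\le r<\infty$, a sequence $(U_n)\subset L^r(\Omega)^m$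 is called *$r$-equiintegrable* if $$\sup\Big\{\int_E|U_n|^r\,dx : n\in\mathbb N,\ E\subset\Omega \text{ measurable},\ |E|\le\delta\Big\}\to 0\ \text{ as }\delta\to0^+,\qquad \sup_{n}\int_{\Omega\setminus B_R}|U_n|^r\,dx\to 0\ \text{ as }R\to\infty,$$ where $B_R$ is the ball of radius $R$ centered at $0$. Let $(u_n)\subset W^{1,p}(\Omega)$ converge weakly in $W^{1,p}(\Omega)$ to $u\in W^{1,p}(\Omega)$, and suppose that $(u_n)$ is $p$- and $p^*$-equiintegrable and that $(Du_n)$ is $p$-equiintegrable. Then $$J(u)\le\liminf_{n\to\infty}J(u_n).$$ If, in addition, $\limsup_{n\to\infty}J(u_n)\le J(u)<\infty$, then $u_n\to u$ strongly in $W^{1,1}_{\mathrm{loc}}(\Omega)$ (that is, $u_n\to u$ and $Du_n\to Du$ in $L^1(K)$ for every compact $K\subset\Omega$), and moreover $Du_n\to Du$ in $L^p(\Omega;\mathbb R^N)$ and $u_n\to u$ in $L^p(\Omega)\cap L^{p^*}(\Omega)$. -/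

import Mathlib

open MeasureTheory Filter Set
open scoped Topology ENNReal NNReal ContDiff

noncomputable section

/-- The Euclidean space `ℝ^N`. -/
abbrev Euc (N : ℕ) : Type := EuclideanSpace ℝ (Fin N)

/-- Lebesgue measure on `Ω ⊆ ℝ^N`. -/
abbrev lebOn {N : ℕ} (Ω : Set (Euc N)) : Measure (Euc N) := (volume : Measure (Euc N)).restrict Ω

/-- A real exponent `p > 1` is also an extended exponent `≥ 1` (so that `L^p` is normed). -/
instance fact_one_le_ofReal (p : ℝ) [hp : Fact (1 < p)] : Fact (1 ≤ ENNReal.ofReal p) :=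
  ⟨by simpa using hp.out.le⟩

/-- `G` is the weak (distributional) gradient of `u` on the open set `Ω`: for every
`φ ∈ C_c^∞(Ω)` and every direction `v`, `∫_Ω u ∂_v φ = - ∫_Ω (G · v) φ`. -/
def IsWeakGradient {N : ℕ} (Ω : Set (Euc N)) (u : Euc N → ℝ) (G : Euc N → Euc N) : Prop :=
  ∀ φ : Euc N → ℝ, ContDiff ℝ ∞ φ → HasCompactSupport φ → tsupport φ ⊆ Ω →
    ∀ v : Euc N, ∫ x in Ω, u x * fderiv ℝ φ x v = -∫ x in Ω, inner ℝ (G x) v * φ x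

/-- A product of an `L^p` function with a continuous compactly supported one is integrable. -/
theorem integrable_Lp_mul {N : ℕ} {Ω : Set (Euc N)} {q : ℝ≥0∞} (hq : 1 ≤ q) {f g : Euc N → ℝ}
    (hf : MemLp f q (lebOn Ω)) (hg : Continuous g) (hgc : HasCompactSupport g) :
    Integrable (fun x => f x * g x) (lebOn Ω) := by
  simpa [mul_comm] using
    (hf.locallyIntegrable hq).integrable_smul_left_of_hasCompactSupport hg hgc

theorem continuous_fderiv_dir {N : ℕ} {φ : Euc N → ℝ} (h : ContDiff ℝ ∞ φ) (v : Euc N) :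
    Continuous (fun x => fderiv ℝ φ x v) :=
  (h.continuous_fderiv (by simp)).clm_apply continuous_const

theorem hasCompactSupport_fderiv_dir {N : ℕ} {φ : Euc N → ℝ} (h : HasCompactSupport φ)
    (v : Euc N) : HasCompactSupport (fun x => fderiv ℝ φ x v) :=
  h.fderiv_apply ℝ v

theorem memLp_inner_dir {N : ℕ} {Ω : Set (Euc N)} {q : ℝ≥0∞} {G : Euc N → Euc N}
    (hG : MemLp G q (lebOn Ω)) (v : Euc N) : MemLp (fun x => inner ℝ (G x) v) q (lebOn Ω) :=
  hG.inner_const v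

/-- The Sobolev space `W^{1,p}(Ω)`, consisting of the pairs `(u, Du)` with `u ∈ L^p(Ω)` and weak
gradient `Du ∈ L^p(Ω; ℝ^N)` (for open `Ω`, `Du` is determined by `u`), with the norm
`max (‖u‖_p) (‖Du‖_p)`, which is equivalent to the usual one. -/
def SobolevW {N : ℕ} (p : ℝ≥0∞) [hp : Fact (1 ≤ p)] (Ω : Set (Euc N)) :
    Submodule ℝ (Lp ℝ p (lebOn Ω) × Lp (Euc N) p (lebOn Ω)) where
  carrier := {w | IsWeakGradient Ω w.1 w.2}
  zero_mem' := by
    intro φ _ _ _ v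
    have h1 : ∫ x in Ω, ((0 : Lp ℝ p (lebOn Ω)) : Euc N → ℝ) x * fderiv ℝ φ x v = 0 := by
      rw [integral_congr_ae (g := fun _ => (0 : ℝ)), integral_zero]
      filter_upwards [Lp.coeFn_zero ℝ p (lebOn Ω)] with x hx
      rw [hx]; simp
    have h2 : ∫ x in Ω, inner ℝ (((0 : Lp (Euc N) p (lebOn Ω)) : Euc N → Euc N) x) v * φ x = 0 := by
      rw [integral_congr_ae (g := fun _ => (0 : ℝ)), integral_zero]
      filter_upwards [Lp.coeFn_zero (Euc N) p (lebOn Ω)] with x hx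
      rw [hx]; simp
    simp only [Prod.fst_zero, Prod.snd_zero, h1, h2, neg_zero]
  add_mem' := by
    rintro ⟨u₁, G₁⟩ ⟨u₂, G₂⟩ h₁ h₂ φ hφ hc hs v
    have e₁ := h₁ φ hφ hc hs v
    have e₂ := h₂ φ hφ hc hs v
    simp only at e₁ e₂
    have c1 := continuous_fderiv_dir hφ v
    have c2 := hasCompactSupport_fderiv_dir hc v
    have l : ∫ x in Ω, ((u₁ + u₂ : Lp ℝ p (lebOn Ω)) : Euc N → ℝ) x * fderiv ℝ φ x v
        = (∫ x in Ω, u₁ x * fderiv ℝ φ x v) + ∫ x in Ω, u₂ x * fderiv ℝ φ x v := by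
      rw [← integral_add (integrable_Lp_mul hp.out (Lp.memLp u₁) c1 c2)
        (integrable_Lp_mul hp.out (Lp.memLp u₂) c1 c2)]
      apply integral_congr_ae
      filter_upwards [Lp.coeFn_add u₁ u₂] with x hx
      rw [hx, Pi.add_apply, add_mul]
    have r : ∫ x in Ω, inner ℝ (((G₁ + G₂ : Lp (Euc N) p (lebOn Ω)) : Euc N → Euc N) x) v * φ x
        = (∫ x in Ω, inner ℝ (G₁ x) v * φ x) + ∫ x in Ω, inner ℝ (G₂ x) v * φ x := by
      rw [← integral_add
        (integrable_Lp_mul hp.out (memLp_inner_dir (Lp.memLp G₁) v) hφ.continuous hc)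
        (integrable_Lp_mul hp.out (memLp_inner_dir (Lp.memLp G₂) v) hφ.continuous hc)]
      apply integral_congr_ae
      filter_upwards [Lp.coeFn_add G₁ G₂] with x hx
      rw [hx, Pi.add_apply, inner_add_left, add_mul]
    simp only [Prod.mk_add_mk]
    rw [l, r, e₁, e₂]
    ring
  smul_mem' := by
    rintro c ⟨u, G⟩ h φ hφ hc hs v
    have e := h φ hφ hc hs v
    simp only at e
    have l : ∫ x in Ω, ((c • u : Lp ℝ p (lebOn Ω)) : Euc N → ℝ) x * fderiv ℝ φ x v
        = c * ∫ x in Ω, u x * fderiv ℝ φ x v := by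
      rw [← integral_const_mul]
      apply integral_congr_ae
      filter_upwards [Lp.coeFn_smul c u] with x hx
      rw [hx, Pi.smul_apply, smul_eq_mul, mul_assoc]
    have r : ∫ x in Ω, inner ℝ (((c • G : Lp (Euc N) p (lebOn Ω)) : Euc N → Euc N) x) v * φ x
        = c * ∫ x in Ω, inner ℝ (G x) v * φ x := by
      rw [← integral_const_mul]
      apply integral_congr_ae
      filter_upwards [Lp.coeFn_smul c G] with x hx
      rw [hx, Pi.smul_apply, inner_smul_left]; simp [mul_assoc]
    simp only [Prod.smul_mk]
    rw [l, r, e]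
    ring

/-- The function `u` underlying an element of `W^{1,p}(Ω)`. -/
def sobFun {N : ℕ} {p : ℝ≥0∞} [Fact (1 ≤ p)] {Ω : Set (Euc N)} (w : SobolevW p Ω) :
    Euc N → ℝ := w.1.1

/-- The weak gradient `Du` of an element of `W^{1,p}(Ω)`. -/
def sobGrad {N : ℕ} {p : ℝ≥0∞} [Fact (1 ≤ p)] {Ω : Set (Euc N)} (w : SobolevW p Ω) :
    Euc N → Euc N := w.1.2

/-- Weak convergence of a sequence in a normed space. -/
def WeaklyConvergesTo {X : Type*} [NormedAddCommGroup X] [NormedSpace ℝ X]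
    (x : ℕ → X) (a : X) : Prop :=
  ∀ ℓ : StrongDual ℝ X, Tendsto (fun n => ℓ (x n)) atTop (𝓝 (ℓ a))

/-- `q` is an admissible value of the critical exponent `p^*` in dimension `N`:
`p^* = pN/(N-p)` if `p < N`; otherwise any number in `(p, ∞)`. -/
def IsCriticalExponent (N : ℕ) (p q : ℝ) : Prop :=
  if p < N then q = p * N / (N - p) else p < q

/-- `W^{1,p}(Ω)` is continuously embedded in `L^q(Ω)`. -/
def SobolevEmbeds {N : ℕ} (p : ℝ≥0∞) [Fact (1 ≤ p)] (Ω : Set (Euc N)) (q : ℝ≥0∞) : Prop :=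
  ∃ K : ℝ≥0, ∀ w : SobolevW p Ω, eLpNorm (sobFun w) q (lebOn Ω) ≤ K * ‖w‖ₑ

/-- `r`-equiintegrability on `Ω` of a sequence in `L^r(Ω)`: no concentration on small sets and
no escape of mass to infinity. -/
def Equiintegrable {N : ℕ} {F : Type*} [NormedAddCommGroup F] (r : ℝ) (Ω : Set (Euc N))
    (U : ℕ → Euc N → F) : Prop :=
  (∀ n, MemLp (U n) (ENNReal.ofReal r) (lebOn Ω)) ∧
  (∀ ε : ℝ≥0∞, 0 < ε → ∃ δ : ℝ≥0∞, 0 < δ ∧ ∀ n, ∀ A : Set (Euc N), MeasurableSet A → A ⊆ Ω →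
    volume A ≤ δ → ∫⁻ x in A, ‖U n x‖ₑ ^ r ≤ ε) ∧
  (∀ ε : ℝ≥0∞, 0 < ε → ∃ R : ℝ, ∀ n, ∫⁻ x in Ω \ Metric.ball 0 R, ‖U n x‖ₑ ^ r ≤ ε)

/-- `j : Ω × ℝ × ℝ^N → ℝ` is a Carathéodory function: (Lebesgue) measurable in `x ∈ Ω` for every
`(μ, ξ)` and continuous in `(μ, ξ)` for a.e. `x ∈ Ω`. Values at `x ∉ Ω` play no role. -/
def IsCaratheodoryIntegrand {N : ℕ} (Ω : Set (Euc N)) (j : Euc N → ℝ → Euc N → ℝ) : Prop :=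
  (∀ (μ : ℝ) (ξ : Euc N), AEMeasurable (fun x => j x μ ξ) (lebOn Ω)) ∧
  (∀ᵐ x ∂(lebOn Ω), Continuous (fun z : ℝ × Euc N => j x z.1 z.2))

/-- `J(u) = ∫_Ω j(x, u, Du) dx` as an extended real number, namely the integral of the positive
part minus the integral of the negative part; the value is `⊥` exactly when the negative part
has infinite integral. -/
def energyJ {N : ℕ} {p : ℝ≥0∞} [Fact (1 ≤ p)] {Ω : Set (Euc N)} (j : Euc N → ℝ → Euc N → ℝ)
    (w : SobolevW p Ω) : EReal :=
  ((∫⁻ x in Ω, ENNReal.ofReal (j x (sobFun w x) (sobGrad w x)) : ℝ≥0∞) : EReal) -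
    ((∫⁻ x in Ω, ENNReal.ofReal (-(j x (sobFun w x) (sobGrad w x))) : ℝ≥0∞) : EReal)

/-- Strong convergence in `W^{1,1}_loc(Ω)`: functions and weak gradients converge in `L^1(K)` for
every compact `K ⊆ Ω`. -/
def TendstoW11Loc {N : ℕ} {p : ℝ≥0∞} [Fact (1 ≤ p)] {Ω : Set (Euc N)}
    (u : ℕ → SobolevW p Ω) (w : SobolevW p Ω) : Prop :=
  ∀ K : Set (Euc N), IsCompact K → K ⊆ Ω →
    Tendsto (fun n => eLpNorm (fun x => sobFun (u n) x - sobFun w x) 1 (lebOn K)) atTop (𝓝 0) ∧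
    Tendsto (fun n => eLpNorm (fun x => sobGrad (u n) x - sobGrad w x) 1 (lebOn K)) atTop (𝓝 0)

/-- Strong convergence `f_n → f` in `L^r(Ω)`. -/
def TendstoLr {N : ℕ} {F : Type*} [NormedAddCommGroup F] (r : ℝ) (Ω : Set (Euc N))
    (f : ℕ → Euc N → F) (g : Euc N → F) : Prop :=
  (∀ n, MemLp (f n) (ENNReal.ofReal r) (lebOn Ω)) ∧ MemLp g (ENNReal.ofReal r) (lebOn Ω) ∧
  Tendsto (fun n => eLpNorm (fun x => f n x - g x) (ENNReal.ofReal r) (lebOn Ω)) atTop (𝓝 0)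

end

/-! The mechanism is a supporting affine function that is stable under perturbation of `u`. Let
`ξ(x)` be a measurable subgradient of `j(x, u(x), ·)` at `Du(x)`, and write `f = j(x, u, Du)`, `f_n
= j(x, u_n, Du_n)`, `b_n = ξ · (Du_n - Du)`. Because `j(x, μ, ·)` is strictly convex and jointly
continuous, the inequality `f + ξ · (η - Du) ≤ j(x, s, η)` survives, up to an arbitrarily small
error and uniformly in `η`, when `s` is close to `u(x)`; it even gains a fixed `c > 0` where `|η -
Du| ≥ ε` (`eventually_sub_le`, `eventually_add_const_le`). Along a subsequence with `u_n → u` a.e.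
(`exists_subseq_ae_sobFun`, local compactness by mollification), this makes the negative part of the
defect `f_n - f - b_n` tend to zero a.e.

On a set of finite measure where `ξ` and `f` are bounded, that negative part is equiintegrable, so
its integral vanishes by Vitali's theorem, and `∫ b_n → 0` by weak convergence of the gradients. Off
such a set the negative parts of `f_n` are uniformly small, by the growth bound and the
equiintegrability hypotheses. This gives lower semicontinuity (`AsympMinorant.extInt_le_liminf`).

If moreover the energies do not exceed `J(u)` in the limit, the same bookkeeping forces the whole
defect to zero in the mean on each set of an exhaustion
(`AsympMinorant.tendsto_defect_of_limsup_le`), hence a.e. along a subsequence. The gain `c` then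
excludes `|Du_n - Du| ≥ ε` for large `n`, so `Du_n → Du` a.e.; equiintegrability upgrades this to
`L^p` convergence, and the subsequence principle removes the extractions. -/

/-! ### Equiintegrability, Vitali's theorem and extended integrals. -/

section MeasureCore

variable {X : Type*} [MeasurableSpace X]

/-- The integrals of the functions `Φ n` over sets of small measure are uniformly small. -/
def LUnif (μ : Measure X) (Φ : ℕ → X → ℝ≥0∞) : Prop :=
  ∀ ε : ℝ≥0∞, 0 < ε → ∃ δ : ℝ≥0∞, 0 < δ ∧ ∀ n, ∀ A : Set X, MeasurableSet A → μ A ≤ δ →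
    ∫⁻ x in A, Φ n x ∂μ ≤ ε

/-- The integrals of the functions `Φ n` off a set of finite measure are uniformly small. -/
def LTight (μ : Measure X) (Φ : ℕ → X → ℝ≥0∞) : Prop :=
  ∀ ε : ℝ≥0∞, 0 < ε → ∃ S : Set X, MeasurableSet S ∧ μ S ≠ ⊤ ∧ ∀ n, ∫⁻ x in Sᶜ, Φ n x ∂μ ≤ ε

variable {μ : Measure X} {Φ Ψ : ℕ → X → ℝ≥0∞}

theorem LUnif.mono (h : LUnif μ Ψ) (hle : ∀ n, ∀ᵐ x ∂μ, Φ n x ≤ Ψ n x) : LUnif μ Φ := by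
  intro ε hε
  obtain ⟨δ, hδ, H⟩ := h ε hε
  exact ⟨δ, hδ, fun n A hA hm =>
    (lintegral_mono_ae (ae_restrict_of_ae (hle n))).trans (H n A hA hm)⟩

theorem LTight.mono (h : LTight μ Ψ) (hle : ∀ n, ∀ᵐ x ∂μ, Φ n x ≤ Ψ n x) : LTight μ Φ := by
  intro ε hε
  obtain ⟨S, hS, hf, H⟩ := h ε hε
  exact ⟨S, hS, hf, fun n => (lintegral_mono_ae (ae_restrict_of_ae (hle n))).trans (H n)⟩

theorem LUnif.add (h : LUnif μ Φ) (h' : LUnif μ Ψ) (hm : ∀ n, AEMeasurable (Φ n) μ) :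
    LUnif μ (fun n x => Φ n x + Ψ n x) := by
  intro ε hε
  obtain ⟨δ, hδ, H⟩ := h (ε / 2) (ENNReal.half_pos hε.ne')
  obtain ⟨δ', hδ', H'⟩ := h' (ε / 2) (ENNReal.half_pos hε.ne')
  refine ⟨min δ δ', lt_min hδ hδ', fun n A hA hA' => ?_⟩
  rw [lintegral_add_left' (hm n).restrict]
  calc _ ≤ ε / 2 + ε / 2 := add_le_add (H n A hA (hA'.trans (min_le_left _ _)))
        (H' n A hA (hA'.trans (min_le_right _ _)))
    _ = ε := ENNReal.add_halves ε

theorem LTight.add (h : LTight μ Φ) (h' : LTight μ Ψ) (hm : ∀ n, AEMeasurable (Φ n) μ) :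
    LTight μ (fun n x => Φ n x + Ψ n x) := by
  intro ε hε
  obtain ⟨S, hS, hf, H⟩ := h (ε / 2) (ENNReal.half_pos hε.ne')
  obtain ⟨S', hS', hf', H'⟩ := h' (ε / 2) (ENNReal.half_pos hε.ne')
  refine ⟨S ∪ S', hS.union hS', (measure_union_lt_top hf.lt_top hf'.lt_top).ne, fun n => ?_⟩
  rw [lintegral_add_left' (hm n).restrict]
  calc _ ≤ ε / 2 + ε / 2 := add_le_add
        ((lintegral_mono_set (compl_subset_compl.2 subset_union_left)).trans (H n))
        ((lintegral_mono_set (compl_subset_compl.2 subset_union_right)).trans (H' n))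
    _ = ε := ENNReal.add_halves ε

theorem LUnif.const_mul (h : LUnif μ Φ) {c : ℝ≥0∞} (hc : c ≠ ⊤) :
    LUnif μ (fun n x => c * Φ n x) := by
  intro ε hε
  rcases eq_or_ne c 0 with rfl | h0
  · exact ⟨1, one_pos, fun n A _ _ => by simp⟩
  obtain ⟨δ, hδ, H⟩ := h (ε / c) (ENNReal.div_pos hε.ne' hc)
  refine ⟨δ, hδ, fun n A hA hA' => ?_⟩
  rw [lintegral_const_mul' _ _ hc]
  calc _ ≤ c * (ε / c) := by gcongr; exact H n A hA hA'
    _ = ε := ENNReal.mul_div_cancel h0 hc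

theorem LTight.const_mul (h : LTight μ Φ) {c : ℝ≥0∞} (hc : c ≠ ⊤) :
    LTight μ (fun n x => c * Φ n x) := by
  intro ε hε
  rcases eq_or_ne c 0 with rfl | h0
  · exact ⟨∅, MeasurableSet.empty, by simp, fun n => by simp⟩
  obtain ⟨S, hS, hf, H⟩ := h (ε / c) (ENNReal.div_pos hε.ne' hc)
  refine ⟨S, hS, hf, fun n => ?_⟩
  rw [lintegral_const_mul' _ _ hc]
  calc _ ≤ c * (ε / c) := by gcongr; exact H n
    _ = ε := ENNReal.mul_div_cancel h0 hc

theorem lUnif_of_integrable {g : X → ℝ≥0∞} (hg : ∫⁻ x, g x ∂μ ≠ ⊤) : LUnif μ (fun _ => g) := by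
  intro ε hε
  obtain ⟨δ, hδ, H⟩ := exists_pos_setLIntegral_lt_of_measure_lt hg hε.ne'
  obtain ⟨δ', h0, h1⟩ := exists_between hδ
  exact ⟨δ', h0, fun n A _ hA => (H A (hA.trans_lt h1)).le⟩

theorem lTight_of_integrable {g : X → ℝ≥0∞} (hg : ∫⁻ x, g x ∂μ ≠ ⊤) :
    LTight μ (fun _ => g) := by
  intro ε hε
  obtain ⟨S, hS, hf, H⟩ := exists_setLIntegral_compl_lt hg hε.ne'
  exact ⟨S, hS, hf.ne, fun n => H.le⟩

theorem lUnif_const {c : ℝ≥0∞} (hc : c ≠ ⊤) : LUnif μ (fun _ _ => c) := by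
  have h1 : LUnif μ (fun _ _ => (1 : ℝ≥0∞)) := fun ε hε => ⟨ε, hε, fun n A _ hA => by simpa⟩
  simpa using h1.const_mul hc

theorem LUnif.restrict (h : LUnif μ Φ) {B : Set X} (hB : MeasurableSet B) :
    LUnif (μ.restrict B) Φ := by
  intro ε hε
  obtain ⟨δ, hδ, H⟩ := h ε hε
  refine ⟨δ, hδ, fun n A hA hm => ?_⟩
  rw [Measure.restrict_apply hA] at hm
  rw [Measure.restrict_restrict hA]
  exact H n _ (hA.inter hB) hm

theorem lTight_of_isFiniteMeasure [IsFiniteMeasure μ] : LTight μ Φ :=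
  fun ε hε => ⟨univ, MeasurableSet.univ, measure_ne_top _ _, fun n => by simp⟩

/-- **Vitali convergence theorem** for functions converging to zero. -/
theorem tendsto_lintegral_zero_of_ae (hm : ∀ n, AEMeasurable (Φ n) μ) (hU : LUnif μ Φ)
    (hT : LTight μ Φ) (h0 : ∀ᵐ x ∂μ, Tendsto (fun n => Φ n x) atTop (𝓝 0)) :
    Tendsto (fun n => ∫⁻ x, Φ n x ∂μ) atTop (𝓝 0) := by
  rw [ENNReal.tendsto_nhds_zero]
  intro ε hε
  have hε3 : 0 < ε / 3 := ENNReal.div_pos hε.ne' (by simp)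
  obtain ⟨S, hS, hf, HS⟩ := hT (ε / 3) hε3
  obtain ⟨δ, hδ, H⟩ := hU (ε / 3) hε3
  -- Truncation at 1 makes dominated convergence available on `S`. The part cut off lives on a set
  -- whose measure is at most the truncated integral, by Markov, so `hU` controls it.
  have hM : Tendsto (fun n => ∫⁻ x in S, min (Φ n x) 1 ∂μ) atTop (𝓝 0) := by
    have := tendsto_lintegral_of_dominated_convergence' (μ := μ.restrict S)
      (F := fun n x => min (Φ n x) 1) (f := fun _ => 0) (fun _ => 1)
      (fun n => ((hm n).restrict.min aemeasurable_const))
      (fun n => ae_of_all _ fun x => min_le_right _ _) (by simp [hf]) ?_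
    · simpa using this
    · filter_upwards [ae_restrict_of_ae h0] with x hx
      simpa using hx.min (tendsto_const_nhds (x := (1 : ℝ≥0∞)))
  filter_upwards [ENNReal.tendsto_nhds_zero.1 hM (ε / 3) hε3, ENNReal.tendsto_nhds_zero.1 hM δ hδ]
    with n hn1 hn2
  -- `Φ n` is only a.e. measurable, so the superlevel set is replaced by a measurable hull of the
  -- same measure.
  set B := toMeasurable (μ.restrict S) {x | 1 ≤ min (Φ n x) 1} with hB
  have hBm : MeasurableSet B := measurableSet_toMeasurable _ _
  have hBle : μ (B ∩ S) ≤ δ := by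
    rw [← Measure.restrict_apply hBm, hB, measure_toMeasurable]
    have := mul_meas_ge_le_lintegral₀ (μ := μ.restrict S)
      ((hm n).restrict.min (aemeasurable_const (b := (1 : ℝ≥0∞)))) 1
    rw [one_mul] at this
    exact this.trans hn2
  have hpt : ∀ x, Φ n x ≤ min (Φ n x) 1 + B.indicator (Φ n) x := by
    intro x
    by_cases hx : x ∈ B
    · simp [hx]
    · have : ¬ (1 ≤ min (Φ n x) 1) := fun h => hx (subset_toMeasurable _ _ h)
      simp only [le_min_iff, le_refl, and_true, not_le] at this
      simp [this.le]
  calc ∫⁻ x, Φ n x ∂μ = ∫⁻ x in S, Φ n x ∂μ + ∫⁻ x in Sᶜ, Φ n x ∂μ :=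
        (lintegral_add_compl _ hS).symm
    _ ≤ (∫⁻ x in S, (min (Φ n x) 1 + B.indicator (Φ n) x) ∂μ) + ε / 3 :=
        add_le_add (lintegral_mono hpt) (HS n)
    _ = ((∫⁻ x in S, min (Φ n x) 1 ∂μ) + ∫⁻ x in B ∩ S, Φ n x ∂μ) + ε / 3 := by
        rw [lintegral_add_left' ((hm n).restrict.min aemeasurable_const), lintegral_indicator hBm,
          Measure.restrict_restrict hBm]
    _ ≤ (ε / 3 + ε / 3) + ε / 3 := by
        gcongr
        exact H n _ (hBm.inter hS) hBle
    _ = ε := ENNReal.add_thirds ε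

/-- The tail of an exhaustion has small measure inside the tight set `S`, which has finite measure,
and everything outside `S` is small already. The same `k` serves all `n`. -/
theorem eventually_setLIntegral_compl_le (hU : LUnif μ Φ)
    (hT : LTight μ Φ) {A : ℕ → Set X} (hA : ∀ k, MeasurableSet (A k)) (hmono : Monotone A)
    (hun : ⋃ k, A k = univ) {ε : ℝ≥0∞} (hε : 0 < ε) :
    ∀ᶠ k in atTop, ∀ n, ∫⁻ x in (A k)ᶜ, Φ n x ∂μ ≤ ε := by
  obtain ⟨S, hS, hf, HS⟩ := hT (ε / 2) (ENNReal.half_pos hε.ne')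
  obtain ⟨δ, hδ, H⟩ := hU (ε / 2) (ENNReal.half_pos hε.ne')
  have hlim : Tendsto (fun k => μ (S ∩ (A k)ᶜ)) atTop (𝓝 0) := by
    have := tendsto_measure_iInter_atTop (μ := μ) (s := fun k => S ∩ (A k)ᶜ)
      (fun k => (hS.inter (hA k).compl).nullMeasurableSet)
      (fun i k hik => inter_subset_inter_right _ (compl_subset_compl.2 (hmono hik)))
      ⟨0, ne_top_of_le_ne_top hf (measure_mono inter_subset_left)⟩
    have he : ⋂ k, S ∩ (A k)ᶜ = ∅ := by
      rw [← inter_iInter, ← compl_iUnion, hun]; simp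
    rw [he, measure_empty] at this
    exact this
  filter_upwards [ENNReal.tendsto_nhds_zero.1 hlim δ hδ] with k hk n
  have hsub : (A k)ᶜ ⊆ (S ∩ (A k)ᶜ) ∪ Sᶜ := by
    intro x hx
    by_cases hxs : x ∈ S
    · exact Or.inl ⟨hxs, hx⟩
    · exact Or.inr hxs
  calc _ ≤ ∫⁻ x in (S ∩ (A k)ᶜ) ∪ Sᶜ, Φ n x ∂μ := lintegral_mono_set hsub
    _ ≤ _ := lintegral_union_le _ _ _
    _ ≤ ε / 2 + ε / 2 := add_le_add (H n _ (hS.inter (hA k).compl) hk) (HS n)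
    _ = ε := ENNReal.add_halves ε

/-- Extended integral of a real function: integral of the positive part minus integral of the
negative part. -/
noncomputable def extInt (μ : Measure X) (f : X → ℝ) : EReal :=
  ((∫⁻ x, ENNReal.ofReal (f x) ∂μ : ℝ≥0∞) : EReal) -
    ((∫⁻ x, ENNReal.ofReal (-(f x)) ∂μ : ℝ≥0∞) : EReal)

theorem extInt_eq_integral {f : X → ℝ} (hf : Integrable f μ) :
    extInt μ f = ((∫ x, f x ∂μ : ℝ) : EReal) := by
  have h1 : ∫⁻ x, ENNReal.ofReal (f x) ∂μ ≠ ⊤ := hf.lintegral_lt_top.ne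
  have h2 : ∫⁻ x, ENNReal.ofReal (-(f x)) ∂μ ≠ ⊤ := hf.neg.lintegral_lt_top.ne
  rw [integral_eq_lintegral_pos_part_sub_lintegral_neg_part hf, extInt, EReal.coe_sub,
    EReal.coe_ennreal_toReal h1, EReal.coe_ennreal_toReal h2]

theorem extInt_ne_bot {f : X → ℝ} (h : ∫⁻ x, ENNReal.ofReal (-(f x)) ∂μ ≠ ⊤) :
    extInt μ f ≠ ⊥ := by
  unfold extInt
  lift (∫⁻ x, ENNReal.ofReal (-(f x)) ∂μ) to ℝ≥0 using h with b
  induction (∫⁻ x, ENNReal.ofReal (f x) ∂μ) with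
  | top => simp
  | coe a => exact EReal.coe_ne_bot ((a : ℝ) - (b : ℝ))

theorem integrable_of_extInt_lt_top {f : X → ℝ} (hm : AEMeasurable f μ)
    (h : ∫⁻ x, ENNReal.ofReal (-(f x)) ∂μ ≠ ⊤) (hlt : extInt μ f < ⊤) : Integrable f μ := by
  have h1 : ∫⁻ x, ENNReal.ofReal (f x) ∂μ ≠ ⊤ := by
    intro h1
    rw [extInt, h1] at hlt
    lift (∫⁻ x, ENNReal.ofReal (-(f x)) ∂μ) to ℝ≥0 using h with b
    exact absurd hlt (by simp)
  refine ⟨hm.aestronglyMeasurable, ?_⟩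
  rw [hasFiniteIntegral_iff_norm]
  have : ∀ x, ENNReal.ofReal ‖f x‖ ≤ ENNReal.ofReal (f x) + ENNReal.ofReal (-(f x)) := by
    intro x
    rcases le_total 0 (f x) with hx | hx
    · rw [Real.norm_of_nonneg hx]; exact le_self_add
    · rw [Real.norm_of_nonpos hx]; exact le_add_self
  refine (lintegral_mono this).trans_lt ?_
  rw [lintegral_add_left' hm.ennreal_ofReal]
  exact ENNReal.add_lt_top.2 ⟨h1.lt_top, h.lt_top⟩

/-- Monotone convergence recovers the positive part, finite or not; restricting to `A k` can only
decrease the integral of the negative part, which works in favour of the bound. -/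
theorem eventually_lt_setIntegral {f : X → ℝ} {A : ℕ → Set X} (hmono : Monotone A)
    (hun : ⋃ k, A k = univ) (hint : ∀ k, IntegrableOn f (A k) μ)
    (h : ∫⁻ x, ENNReal.ofReal (-(f x)) ∂μ ≠ ⊤) {c : ℝ} (hc : (c : EReal) < extInt μ f) :
    ∀ᶠ k in atTop, c < ∫ x in A k, f x ∂μ := by
  have hlim : Tendsto (fun k => ∫⁻ x in A k, ENNReal.ofReal (f x) ∂μ) atTop
      (𝓝 (∫⁻ x, ENNReal.ofReal (f x) ∂μ)) := by
    have e := setLIntegral_iUnion_of_directed (μ := μ) (fun x => ENNReal.ofReal (f x))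
      hmono.directed_le
    rw [hun, Measure.restrict_univ] at e
    rw [e]
    exact tendsto_atTop_iSup fun i k hik => lintegral_mono_set (hmono hik)
  have hlim' : Tendsto (fun k => ((∫⁻ x in A k, ENNReal.ofReal (f x) ∂μ : ℝ≥0∞) : EReal)) atTop
      (𝓝 ((∫⁻ x, ENNReal.ofReal (f x) ∂μ : ℝ≥0∞) : EReal)) :=
    (continuous_coe_ennreal_ereal.tendsto _).comp hlim
  have hc' : (c : EReal) + ((∫⁻ x, ENNReal.ofReal (-(f x)) ∂μ : ℝ≥0∞) : EReal) <
      ((∫⁻ x, ENNReal.ofReal (f x) ∂μ : ℝ≥0∞) : EReal) := by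
    rw [extInt] at hc
    exact EReal.add_lt_of_lt_sub hc
  filter_upwards [hlim'.eventually_const_lt hc'] with k hk
  have h1 : (c : EReal) < extInt (μ.restrict (A k)) f := by
    rw [extInt]
    have hle : ((∫⁻ x in A k, ENNReal.ofReal (-(f x)) ∂μ : ℝ≥0∞) : EReal) ≤
      ((∫⁻ x, ENNReal.ofReal (-(f x)) ∂μ : ℝ≥0∞) : EReal) :=
      EReal.coe_ennreal_le_coe_ennreal_iff.2 (setLIntegral_le_lintegral _ _)
    have h3 : ∫⁻ x in A k, ENNReal.ofReal (-(f x)) ∂μ ≠ ⊤ :=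
      ne_top_of_le_ne_top h (setLIntegral_le_lintegral _ _)
    rw [EReal.lt_sub_iff_add_lt (by simp) (by simp)]
    exact (add_le_add le_rfl hle).trans_lt hk
  rw [extInt_eq_integral (hint k)] at h1
  exact_mod_cast h1

end MeasureCore

/-! ### Lower semicontinuity and convergence of defects under asymptotic minorants. -/

section AsymptoticMinorant

variable {X : Type*} [MeasurableSpace X]

/-- The functions `f + b n` are asymptotically pointwise minorants of `fn n`, where `b n` is
dominated by `m` times a uniformly integrable sequence and tends to zero in the mean on sets of
finite measure where `m` is bounded; the negative parts of `fn n` are equiintegrable. -/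
structure AsympMinorant (μ : Measure X) (f : X → ℝ) (fn b : ℕ → X → ℝ) (m : X → ℝ)
    (D H : ℕ → X → ℝ≥0∞) : Prop where
  meas_f : Measurable f
  neg_f : ∫⁻ x, ENNReal.ofReal (-(f x)) ∂μ ≠ ⊤
  meas_fn : ∀ n, AEMeasurable (fn n) μ
  meas_b : ∀ n, AEMeasurable (b n) μ
  meas_m : Measurable m
  meas_D : ∀ n, AEMeasurable (D n) μ
  meas_H : ∀ n, AEMeasurable (H n) μ
  unif_D : LUnif μ D
  unif_H : LUnif μ H
  tight_H : LTight μ H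
  le_H : ∀ n, ∀ᵐ x ∂μ, ENNReal.ofReal (-(fn n x)) ≤ H n x
  le_D : ∀ n, ∀ᵐ x ∂μ, ‖b n x‖ₑ ≤ ENNReal.ofReal (m x) * D n x
  int_b : ∀ n, ∀ A, MeasurableSet A → μ A ≠ ⊤ → (∃ M, ∀ x ∈ A, m x ≤ M) → IntegrableOn (b n) A μ
  mean_b : ∀ A, MeasurableSet A → μ A ≠ ⊤ → (∃ M, ∀ x ∈ A, m x ≤ M) →
    Tendsto (fun n => ∫ x in A, b n x ∂μ) atTop (𝓝 0)
  minorant : ∀ᵐ x ∂μ, ∀ κ : ℝ, 0 < κ → ∀ᶠ n in atTop, f x + b n x - κ ≤ fn n x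

variable {μ : Measure X} {f : X → ℝ} {fn b : ℕ → X → ℝ} {m : X → ℝ} {D H : ℕ → X → ℝ≥0∞}

namespace AsympMinorant

/-- `ENNReal.ofReal` keeps only the amount by which `fn n` falls below `f + b n`. This amount tends
to zero a.e. by the minorant property and is equiintegrable on `A`, so Vitali's theorem applies. -/
theorem tendsto_defect (h : AsympMinorant μ f fn b m D H) {A : Set X} (hA : MeasurableSet A)
    (hf : μ A ≠ ⊤) {M : ℝ} (hM : ∀ x ∈ A, m x ≤ M) (hfM : ∀ x ∈ A, |f x| ≤ M) :
    Tendsto (fun n => ∫⁻ x in A, ENNReal.ofReal (f x + b n x - fn n x) ∂μ) atTop (𝓝 0) := by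
  have : IsFiniteMeasure (μ.restrict A) := ⟨by simpa using hf.lt_top⟩
  refine tendsto_lintegral_zero_of_ae (fun n => ?_) ?_ lTight_of_isFiniteMeasure ?_
  · exact (((h.meas_f.aemeasurable.add (h.meas_b n)).sub (h.meas_fn n)).ennreal_ofReal).restrict
  -- The three summands bound `f`, `b n` and the negative part of `fn n` respectively.
  · have h1 : LUnif (μ.restrict A) (fun n x => ENNReal.ofReal M + (ENNReal.ofReal M * D n x
        + H n x)) := by
      refine LUnif.add (lUnif_const ENNReal.ofReal_ne_top) ?_ (fun n => aemeasurable_const)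
      refine LUnif.add ((h.unif_D.restrict hA).const_mul ENNReal.ofReal_ne_top)
        (h.unif_H.restrict hA) (fun n => ((h.meas_D n).const_mul _).restrict)
    refine h1.mono fun n => ?_
    filter_upwards [ae_restrict_mem hA, ae_restrict_of_ae (h.le_H n),
      ae_restrict_of_ae (h.le_D n)] with x hx h2 h3
    calc ENNReal.ofReal (f x + b n x - fn n x)
        ≤ ENNReal.ofReal (M + (|b n x| + -(fn n x))) := by
          apply ENNReal.ofReal_le_ofReal
          have := le_abs_self (f x); have := le_abs_self (b n x); have := hfM x hx
          linarith
      _ ≤ ENNReal.ofReal M + (ENNReal.ofReal |b n x| + ENNReal.ofReal (-(fn n x))) :=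
          ENNReal.ofReal_add_le.trans (by gcongr; exact ENNReal.ofReal_add_le)
      _ ≤ _ := by
          gcongr
          rw [← Real.enorm_eq_ofReal_abs]
          refine h3.trans ?_
          gcongr
          exact hM x hx
  · filter_upwards [ae_restrict_of_ae h.minorant] with x hx
    rw [ENNReal.tendsto_nhds_zero]
    intro ε hε
    obtain ⟨κ, hκ0, hκ⟩ := ENNReal.lt_iff_exists_nnreal_btwn.1 hε
    filter_upwards [hx κ (by exact_mod_cast hκ0)] with n hn
    refine le_trans ?_ hκ.le
    rw [← ENNReal.ofReal_coe_nnreal]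
    exact ENNReal.ofReal_le_ofReal (by linarith)

/-- An exhaustion by sets of finite measure on which `m` and `f` are bounded. -/
theorem exists_exhaustion [SigmaFinite μ] (h : AsympMinorant μ f fn b m D H) :
    ∃ A : ℕ → Set X, (∀ k, MeasurableSet (A k)) ∧ Monotone A ∧ ⋃ k, A k = univ ∧
      (∀ k, μ (A k) ≠ ⊤) ∧ (∀ k, ∀ x ∈ A k, m x ≤ k) ∧ (∀ k, ∀ x ∈ A k, |f x| ≤ k) := by
  refine ⟨fun k => spanningSets μ k ∩ {x | max (m x) |f x| ≤ k}, fun k => ?_, ?_, ?_, fun k => ?_,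
    fun k x hx => (le_max_left _ _).trans hx.2, fun k x hx => (le_max_right _ _).trans hx.2⟩
  · exact (measurableSet_spanningSets μ k).inter
      (measurableSet_le (h.meas_m.max h.meas_f.abs) measurable_const)
  · intro i k hik x hx
    have hik' : (i : ℝ) ≤ k := by exact_mod_cast hik
    exact ⟨monotone_spanningSets μ hik hx.1, le_trans (b := (i : ℝ)) hx.2 hik'⟩
  · rw [eq_univ_iff_forall]
    intro x
    have hx : x ∈ ⋃ k, spanningSets μ k := by rw [iUnion_spanningSets]; trivial
    obtain ⟨k, hk⟩ := mem_iUnion.1 hx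
    obtain ⟨l, hl⟩ := exists_nat_ge (max (m x) |f x|)
    refine mem_iUnion.2 ⟨max k l, monotone_spanningSets μ (le_max_left _ _) hk, hl.trans ?_⟩
    exact_mod_cast le_max_right k l
  · exact ne_top_of_le_ne_top (measure_spanningSets_lt_top μ k).ne (measure_mono inter_subset_left)

theorem integrableOn_f (h : AsympMinorant μ f fn b m D H) {A : Set X} (hA : MeasurableSet A)
    (hf : μ A ≠ ⊤) {M : ℝ} (hfM : ∀ x ∈ A, |f x| ≤ M) : IntegrableOn f A μ := by
  refine Measure.integrableOn_of_bounded (M := M) hf h.meas_f.aestronglyMeasurable ?_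
  filter_upwards [ae_restrict_mem hA] with x hx using hfM x hx

theorem neg_fn_ne_top (h : AsympMinorant μ f fn b m D H) (hfin : ∀ n, ∫⁻ x, H n x ∂μ ≠ ⊤) (n : ℕ) :
    ∫⁻ x, ENNReal.ofReal (-(fn n x)) ∂μ ≠ ⊤ :=
  ne_top_of_le_ne_top (hfin n) (lintegral_mono_ae (h.le_H n))

theorem neg_le_setIntegral (h : AsympMinorant μ f fn b m D H) {n : ℕ}
    {B : Set X} {η : ℝ} (hη : 0 ≤ η)
    (hB : ∫⁻ x in B, H n x ∂μ ≤ ENNReal.ofReal η) (hi : Integrable (fn n) μ) :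
    -η ≤ ∫ x in B, fn n x ∂μ := by
  have h1 : ∫⁻ x in B, ENNReal.ofReal (-(fn n x)) ∂μ ≤ ENNReal.ofReal η :=
    (lintegral_mono_ae (ae_restrict_of_ae (h.le_H n))).trans hB
  rw [integral_eq_lintegral_pos_part_sub_lintegral_neg_part hi.integrableOn]
  have h2 := ENNReal.toReal_mono ENNReal.ofReal_ne_top h1
  rw [ENNReal.toReal_ofReal hη] at h2
  have h3 : 0 ≤ (∫⁻ x in B, ENNReal.ofReal (fn n x) ∂μ).toReal := ENNReal.toReal_nonneg
  linarith

theorem setIntegral_defect (h : AsympMinorant μ f fn b m D H) {A : Set X} (hA : MeasurableSet A)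
    (hf : μ A ≠ ⊤) {M : ℝ} (hM : ∀ x ∈ A, m x ≤ M) (hfM : ∀ x ∈ A, |f x| ≤ M) {n : ℕ}
    (hi : Integrable (fn n) μ) :
    ∫ x in A, (fn n x - f x - b n x) ∂μ = (∫ x in A, fn n x ∂μ) - (∫ x in A, f x ∂μ) -
      ∫ x in A, b n x ∂μ := by
  have h1 := h.integrableOn_f hA hf hfM
  have h2 := h.int_b n A hA hf ⟨M, hM⟩
  have e := integral_sub (hi.integrableOn (s := A) |>.sub h1) h2
  simp only [Pi.sub_apply] at e
  rw [e, integral_sub hi.integrableOn h1]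

theorem integrableOn_defect (h : AsympMinorant μ f fn b m D H) {A : Set X} (hA : MeasurableSet A)
    (hf : μ A ≠ ⊤) {M : ℝ} (hM : ∀ x ∈ A, m x ≤ M) (hfM : ∀ x ∈ A, |f x| ≤ M) {n : ℕ}
    (hi : Integrable (fn n) μ) : IntegrableOn (fun x => fn n x - f x - b n x) A μ :=
  (hi.integrableOn.sub (h.integrableOn_f hA hf hfM)).sub (h.int_b n A hA hf ⟨M, hM⟩)

theorem eventually_neg_defect_le (h : AsympMinorant μ f fn b m D H) {A : Set X}
    (hA : MeasurableSet A)
    (hf : μ A ≠ ⊤) {M : ℝ} (hM : ∀ x ∈ A, m x ≤ M) (hfM : ∀ x ∈ A, |f x| ≤ M) {η : ℝ}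
    (hη : 0 < η) : ∀ᶠ n in atTop,
      ∫⁻ x in A, ENNReal.ofReal (-(fn n x - f x - b n x)) ∂μ ≤ ENNReal.ofReal η := by
  filter_upwards [ENNReal.tendsto_nhds_zero.1 (h.tendsto_defect hA hf hM hfM) (ENNReal.ofReal η)
    (by simpa using hη)] with n hn
  refine le_trans (le_of_eq ?_) hn
  congr 1; ext x; congr 1; ring

/-- Lower semicontinuity under asymptotic minorants. -/
theorem extInt_le_liminf [SigmaFinite μ] (h : AsympMinorant μ f fn b m D H)
    (hfin : ∀ n, ∫⁻ x, H n x ∂μ ≠ ⊤) :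
    extInt μ f ≤ liminf (fun n => extInt μ (fn n)) atTop := by
  refine EReal.ge_of_forall_gt_iff_ge.1 fun c hc => ?_
  obtain ⟨A, hA, hmono, hun, hfA, hmA, hfM⟩ := h.exists_exhaustion
  obtain ⟨d, hcd, hd⟩ := EReal.lt_iff_exists_real_btwn.1 hc
  have hcd' : c < d := by exact_mod_cast hcd
  -- Three errors of size `η` separate `d < ∫ f` on `A k` from `c`: the tail of `fn n` off `A k`,
  -- the mean of `b n`, and the negative part of the defect.
  set η := (d - c) / 3 with hηd
  have hη : 0 < η := by rw [hηd]; linarith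
  have e1 := eventually_lt_setIntegral hmono hun
    (fun k => h.integrableOn_f (hA k) (hfA k) (hfM k)) h.neg_f hd
  have e2 := eventually_setLIntegral_compl_le h.unif_H h.tight_H hA hmono hun
    (ε := ENNReal.ofReal η) (by simpa using hη)
  obtain ⟨k, hk1, hk2⟩ := (e1.and e2).exists
  have e3 := (h.mean_b (A k) (hA k) (hfA k) ⟨k, hmA k⟩).eventually_const_lt (neg_lt_zero.2 hη)
  have e4 := h.eventually_neg_defect_le (hA k) (hfA k) (hmA k) (hfM k) hη
  refine le_liminf_of_le (by isBoundedDefault) ?_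
  filter_upwards [e3, e4] with n h3 h4
  by_cases htop : extInt μ (fn n) = ⊤
  · rw [htop]; exact le_top
  have hi := integrable_of_extInt_lt_top (h.meas_fn n) (h.neg_fn_ne_top hfin n)
    (lt_top_iff_ne_top.2 htop)
  rw [extInt_eq_integral hi, ← integral_add_compl (hA k) hi]
  have h5 := h.neg_le_setIntegral hη.le (hk2 n) hi
  have h6 := h.setIntegral_defect (hA k) (hfA k) (hmA k) (hfM k) hi
  have h7 : -η ≤ ∫ x in A k, (fn n x - f x - b n x) ∂μ := by
    have hid := h.integrableOn_defect (hA k) (hfA k) (hmA k) (hfM k) hi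
    rw [integral_eq_lintegral_pos_part_sub_lintegral_neg_part hid]
    have h8 := ENNReal.toReal_mono ENNReal.ofReal_ne_top h4
    rw [ENNReal.toReal_ofReal hη.le] at h8
    have h9 := ENNReal.toReal_nonneg
      (a := ∫⁻ x in A k, ENNReal.ofReal (fn n x - f x - b n x) ∂μ)
    linarith
  have : c ≤ (∫ x in A k, fn n x ∂μ) + ∫ x in (A k)ᶜ, fn n x ∂μ := by
    have : η * 3 = d - c := by rw [hηd]; ring
    linarith
  exact_mod_cast this

/-- If the energies converge, then the defects tend to zero locally in the mean. -/
theorem tendsto_defect_of_limsup_le [SigmaFinite μ] (h : AsympMinorant μ f fn b m D H)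
    (hfin : ∀ n, ∫⁻ x, H n x ∂μ ≠ ⊤)
    (hls : limsup (fun n => extInt μ (fn n)) atTop ≤ extInt μ f) (hlt : extInt μ f < ⊤) :
    ∃ A : ℕ → Set X, (∀ k, MeasurableSet (A k)) ∧ Monotone A ∧ ⋃ k, A k = univ ∧
      ∀ k, Tendsto (fun n => ∫⁻ x in A k, ‖fn n x - f x - b n x‖ₑ ∂μ) atTop (𝓝 0) := by
  obtain ⟨A, hA, hmono, hun, hfA, hmA, hfM⟩ := h.exists_exhaustion
  refine ⟨A, hA, hmono, hun, fun i => ?_⟩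
  rw [ENNReal.tendsto_nhds_zero]
  intro ε hε
  obtain ⟨κ, hκ0, hκ⟩ := ENNReal.lt_iff_exists_nnreal_btwn.1 hε
  have hκ0' : (0 : ℝ) < κ := by exact_mod_cast hκ0
  -- The integral of the defect over `A k` is below `4 * η` (energy gap, tail of `fn n`, tail of
  -- `f`, mean of `b n`). Passing to the absolute value adds twice the negative part, at most `2 *
  -- η`; the seventh share is slack.
  set η : ℝ := κ / 7 with hηd
  have hη : 0 < η := by rw [hηd]; linarith
  have hif := integrable_of_extInt_lt_top h.meas_f.aemeasurable h.neg_f hlt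
  have hJ := extInt_eq_integral hif
  have e1 : ∀ᶠ k in atTop, (∫ x, f x ∂μ) - η < ∫ x in A k, f x ∂μ := by
    refine eventually_lt_setIntegral hmono hun
      (fun k => h.integrableOn_f (hA k) (hfA k) (hfM k)) h.neg_f ?_
    rw [hJ]; exact_mod_cast sub_lt_self _ hη
  have e2 := eventually_setLIntegral_compl_le h.unif_H h.tight_H hA hmono hun
    (ε := ENNReal.ofReal η) (by simpa using hη)
  -- The estimate needs a set large enough for the precision `η`, so it is made on some `A k ⊇ A i`
  -- and restricted to `A i` at the end.
  obtain ⟨k, ⟨hk1, hk2⟩, hik⟩ := ((e1.and e2).and (eventually_ge_atTop i)).exists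
  have e3 := (h.mean_b (A k) (hA k) (hfA k) ⟨k, hmA k⟩).eventually_const_lt (neg_lt_zero.2 hη)
  have e4 := h.eventually_neg_defect_le (hA k) (hfA k) (hmA k) (hfM k) hη
  have e5 : ∀ᶠ n in atTop, extInt μ (fn n) < (((∫ x, f x ∂μ) + η : ℝ) : EReal) := by
    refine eventually_lt_of_limsup_lt (hls.trans_lt ?_) (by isBoundedDefault)
    rw [hJ]; exact_mod_cast lt_add_of_pos_right _ hη
  filter_upwards [e3, e4, e5] with n h3 h4 h5
  have hi := integrable_of_extInt_lt_top (h.meas_fn n) (h.neg_fn_ne_top hfin n)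
    (h5.trans (EReal.coe_lt_top _))
  rw [extInt_eq_integral hi, ← integral_add_compl (hA k) hi] at h5
  have h5' : (∫ x in A k, fn n x ∂μ) + ∫ x in (A k)ᶜ, fn n x ∂μ < (∫ x, f x ∂μ) + η := by
    exact_mod_cast h5
  have h6 := h.neg_le_setIntegral hη.le (hk2 n) hi
  have h7 := h.setIntegral_defect (hA k) (hfA k) (hmA k) (hfM k) hi
  have hid := h.integrableOn_defect (hA k) (hfA k) (hmA k) (hfM k) hi
  have h10 : ∫ x in A k, ‖fn n x - f x - b n x‖ ∂μ ≤ κ := by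
    have e : ∀ x, ‖fn n x - f x - b n x‖ =
        (fn n x - f x - b n x) + 2 * max (-(fn n x - f x - b n x)) 0 := by
      intro x
      rw [Real.norm_eq_abs]
      rcases le_total 0 (fn n x - f x - b n x) with hx | hx
      · rw [abs_of_nonneg hx, max_eq_right (by linarith)]; ring
      · rw [abs_of_nonpos hx, max_eq_left (by linarith)]; ring
    have hpos : IntegrableOn (fun x => max (-(fn n x - f x - b n x)) 0) (A k) μ :=
      hid.neg.pos_part
    have hneg : ∫ x in A k, max (-(fn n x - f x - b n x)) 0 ∂μ ≤ η := by
      rw [integral_eq_lintegral_of_nonneg_ae (ae_of_all _ fun x => by simp)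
        hpos.aestronglyMeasurable]
      refine ENNReal.toReal_le_of_le_ofReal hη.le (le_trans (le_of_eq ?_) h4)
      congr 1; ext x
      rw [ENNReal.ofReal_max]; simp
    simp_rw [e]
    rw [integral_add hid (hpos.const_mul 2), integral_const_mul]
    have : κ = 7 * η := by rw [hηd]; ring
    linarith
  calc ∫⁻ x in A i, ‖fn n x - f x - b n x‖ₑ ∂μ
      ≤ ∫⁻ x in A k, ‖fn n x - f x - b n x‖ₑ ∂μ := lintegral_mono_set (hmono hik)
    _ = ENNReal.ofReal (∫ x in A k, ‖fn n x - f x - b n x‖ ∂μ) :=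
        (ofReal_integral_norm_eq_lintegral_enorm hid).symm
    _ ≤ ENNReal.ofReal κ := ENNReal.ofReal_le_ofReal h10
    _ ≤ ε := by rw [ENNReal.ofReal_coe_nnreal]; exact hκ.le

end AsympMinorant

/-- Local convergence in the mean on an exhausting sequence of sets gives almost everywhere
convergence of a subsequence. -/
theorem exists_subseq_ae_of_setLIntegral [SigmaFinite μ] {E : Type*} [NormedAddCommGroup E]
    {g : ℕ → X → E} (hg : ∀ n, AEStronglyMeasurable (g n) μ) {A : ℕ → Set X}
    (hA : ∀ k, MeasurableSet (A k)) (hmono : Monotone A) (hun : ∀ᵐ x ∂μ, x ∈ ⋃ k, A k)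
    (h : ∀ k, Tendsto (fun n => ∫⁻ x in A k, ‖g n x‖ₑ ∂μ) atTop (𝓝 0)) :
    ∃ s : ℕ → ℕ, StrictMono s ∧ ∀ᵐ x ∂μ, Tendsto (fun n => g (s n) x) atTop (𝓝 0) := by
  -- For a finite measure with the same null sets the complements of `A k` have measure tending to
  -- zero, so local convergence becomes global convergence in measure.
  have hν : μ.toFinite ≪ μ := toFinite_absolutelyContinuous μ
  have hin : TendstoInMeasure μ.toFinite g atTop (fun _ => (0 : E)) := by
    intro ε hε
    rw [ENNReal.tendsto_nhds_zero]
    intro δ hδ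
    have hlim : Tendsto (fun k => μ.toFinite (A k)ᶜ) atTop (𝓝 0) := by
      have := tendsto_measure_iInter_atTop (μ := μ.toFinite) (s := fun k => (A k)ᶜ)
        (fun k => (hA k).compl.nullMeasurableSet)
        (fun i k hik => compl_subset_compl.2 (hmono hik)) ⟨0, measure_ne_top _ _⟩
      have he : μ.toFinite (⋂ k, (A k)ᶜ) = 0 := by
        rw [← compl_iUnion]
        exact hν (mem_ae_iff.1 hun)
      rw [he] at this
      exact this
    obtain ⟨k, hk⟩ := (ENNReal.tendsto_nhds_zero.1 hlim (δ / 2)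
      (ENNReal.half_pos hδ.ne')).exists
    -- Convergence in measure is transferred from `μ` to `μ.toFinite` through the subsequence
    -- criterion, since a.e. convergence depends only on null sets.
    have hin2 : TendstoInMeasure (μ.toFinite.restrict (A k)) g atTop (fun _ => (0 : E)) := by
      rw [exists_seq_tendstoInMeasure_atTop_iff
        (fun n => ((hg n).mono_ac hν).restrict)]
      intro ns hns
      have hL : Tendsto (fun n => eLpNorm (g n - fun _ => (0 : E)) 1 (μ.restrict (A k))) atTop
          (𝓝 0) := by
        simpa [eLpNorm_one_eq_lintegral_enorm] using h k
      obtain ⟨ns', h1, h2⟩ := ((tendstoInMeasure_of_tendsto_eLpNorm one_ne_zero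
        (fun n => (hg n).restrict) aestronglyMeasurable_const hL).comp
          hns.tendsto_atTop).exists_seq_tendsto_ae
      exact ⟨ns', h1, (hν.restrict (A k)).ae_le h2⟩
    filter_upwards [ENNReal.tendsto_nhds_zero.1 (hin2 ε hε) (δ / 2)
      (ENNReal.half_pos hδ.ne')] with n hn
    calc μ.toFinite {x | ε ≤ edist (g n x) 0}
        ≤ μ.toFinite ({x | ε ≤ edist (g n x) 0} ∩ A k) + μ.toFinite (A k)ᶜ := by
          refine (measure_mono ?_).trans (measure_union_le _ _)
          intro x hx
          by_cases hxA : x ∈ A k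
          · exact Or.inl ⟨hx, hxA⟩
          · exact Or.inr hxA
      _ ≤ δ / 2 + δ / 2 := by
          gcongr
          rw [← Measure.restrict_apply' (hA k)]
          exact hn
      _ = δ := ENNReal.add_halves δ
  obtain ⟨s, hs, hs'⟩ := hin.exists_seq_tendsto_ae
  exact ⟨s, hs, (absolutelyContinuous_toFinite μ).ae_le hs'⟩

end AsymptoticMinorant

/-! ### Stability of supporting affine functions of strictly convex functions. -/

section ConvexStability

variable {E : Type*} [NormedAddCommGroup E] [InnerProductSpace ℝ E]

/-- Stability, under perturbation of the parameter, of the affine minorant of a strictly convex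
function given by a subgradient. -/
theorem eventually_add_const_le [ProperSpace E] {φ : ℝ → E → ℝ}
    (hcont : Continuous fun z : ℝ × E => φ z.1 z.2)
    (hconv : ∀ μ, StrictConvexOn ℝ univ (φ μ)) {t : ℝ} {a ξ : E}
    (hsub : ∀ η, φ t a + inner ℝ ξ (η - a) ≤ φ t η) {ε : ℝ} (hε : 0 < ε) :
    ∃ c > 0, ∀ᶠ s in 𝓝 t, ∀ η, ε ≤ ‖η - a‖ → φ t a + inner ℝ ξ (η - a) + c ≤ φ s η := by
  -- Removing the affine function and centring at `a` leaves strictly convex `F s`, where `F t` is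
  -- nonnegative and vanishes only at the origin.
  set F : ℝ → E → ℝ := fun s v => φ s (a + v) - φ t a - inner ℝ ξ v with hF
  have hFc : Continuous fun z : ℝ × E => F z.1 z.2 := by
    have : Continuous fun z : ℝ × E => φ z.1 (a + z.2) :=
      hcont.comp (continuous_fst.prodMk (continuous_const.add continuous_snd))
    fun_prop
  have hF0 : F t 0 = 0 := by simp [hF]
  have hFnn : ∀ v, 0 ≤ F t v := fun v => by
    have := hsub (a + v); simp only [add_sub_cancel_left] at this; simp only [hF]; linarith
  have hFs : ∀ s, StrictConvexOn ℝ univ (F s) := by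
    intro s
    refine ⟨convex_univ, fun x _ y _ hxy p q hp hq hpq => ?_⟩
    have h := (hconv s).2 (mem_univ (a + x)) (mem_univ (a + y)) (by simpa using hxy) hp hq hpq
    have e : p • (a + x) + q • (a + y) = a + (p • x + q • y) := by
      rw [smul_add, smul_add, add_add_add_comm, ← add_smul, hpq, one_smul]
    rw [e] at h
    simp only [hF, smul_eq_mul, inner_add_right, inner_smul_right] at h ⊢
    have : φ t a = p * φ t a + q * φ t a := by rw [← add_mul, hpq, one_mul]
    linarith
  have hFpos : ∀ v, v ≠ 0 → 0 < F t v := by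
    intro v hv
    have h := (hFs t).2 (mem_univ (0 : E)) (mem_univ v) hv.symm
      (by norm_num : (0 : ℝ) < 1 / 2) (by norm_num : (0 : ℝ) < 1 / 2) (by norm_num)
    rw [hF0] at h
    have := hFnn ((1 / 2 : ℝ) • (0 : E) + (1 / 2 : ℝ) • v)
    simp only [smul_eq_mul] at h
    linarith
  have hS : IsCompact (Metric.sphere (0 : E) ε) := isCompact_sphere _ _
  -- Budget: `4 * c` on the sphere becomes `3 * c` for nearby `s`; the value at the origin costs up
  -- to `c`, both in the increment along a ray (leaving `2 * c`) and in the final value (leaving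
  -- `c`).
  obtain ⟨c, hc, hcS⟩ : ∃ c > 0, ∀ v ∈ Metric.sphere (0 : E) ε, 4 * c ≤ F t v := by
    rcases (Metric.sphere (0 : E) ε).eq_empty_or_nonempty with he | hne
    · exact ⟨1, one_pos, by simp [he]⟩
    obtain ⟨v, hv, hmin⟩ := hS.exists_isMinOn hne
      (hFc.comp (continuous_const.prodMk continuous_id : Continuous fun v : E => (t, v))).continuousOn
    have hv0 : v ≠ 0 := by
      rintro rfl
      rw [mem_sphere_zero_iff_norm, norm_zero] at hv
      exact hε.ne hv
    refine ⟨F t v / 4, by have := hFpos v hv0; positivity, fun w hw => ?_⟩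
    have : F t v ≤ F t w := hmin hw
    linarith
  refine ⟨c, hc, ?_⟩
  have h1 : ∀ᶠ s in 𝓝 t, ∀ v ∈ Metric.sphere (0 : E) ε, 3 * c < F s v := by
    refine hS.eventually_forall_of_forall_eventually fun v hv => ?_
    exact (hFc.tendsto (t, v)).eventually_const_lt (by have := hcS v hv; simp only; linarith)
  have h2 : ∀ᶠ s in 𝓝 t, |F s 0| < c := by
    have : Tendsto (fun s => |F s 0|) (𝓝 t) (𝓝 |F t 0|) :=
      ((hFc.comp (continuous_id.prodMk continuous_const : Continuous fun s : ℝ => (s, (0 : E)))).abs).tendsto t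
    exact this.eventually_lt_const (by simpa [hF0] using hc)
  filter_upwards [h1, h2] with s hs1 hs2 η hη
  have hpos : 0 < ‖η - a‖ := hε.trans_le hη
  -- Scaling by `r ≤ 1` brings `η - a` onto the sphere; convexity on the segment from the origin
  -- propagates the increment outward.
  set r := ε / ‖η - a‖ with hr
  have hr0 : 0 < r := by positivity
  have hr1 : r ≤ 1 := (div_le_one hpos).2 hη
  have hmem : r • (η - a) ∈ Metric.sphere (0 : E) ε := by
    rw [mem_sphere_zero_iff_norm, norm_smul, Real.norm_of_nonneg hr0.le, hr]
    field_simp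
  have h3 := (hFs s).convexOn.2 (mem_univ (0 : E)) (mem_univ (η - a)) (sub_nonneg.2 hr1) hr0.le
    (by ring)
  have h4 := hs1 _ hmem
  simp only [smul_zero, zero_add, smul_eq_mul] at h3
  rw [abs_lt] at hs2
  have h5 : 2 * c ≤ r * (F s (η - a) - F s 0) := by nlinarith
  have h6 : 2 * c ≤ F s (η - a) - F s 0 := by
    by_contra hlt
    push Not at hlt
    have : 0 < F s (η - a) - F s 0 := by
      by_contra h0
      push Not at h0
      nlinarith
    nlinarith
  have h7 : c ≤ F s (η - a) := by linarith
  simp only [hF, add_sub_cancel] at h7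
  linarith

/-- Far from `a` the gain of `eventually_add_const_le` is more than enough, and on the compact unit
ball about `a` continuity in the parameter is uniform. Strictness matters for uniformity in `η`: `φ
s η = s * η` on the line fails at `t = 0`. -/
theorem eventually_sub_le [ProperSpace E] {φ : ℝ → E → ℝ}
    (hcont : Continuous fun z : ℝ × E => φ z.1 z.2)
    (hconv : ∀ μ, StrictConvexOn ℝ univ (φ μ)) {t : ℝ} {a ξ : E}
    (hsub : ∀ η, φ t a + inner ℝ ξ (η - a) ≤ φ t η) {κ : ℝ} (hκ : 0 < κ) :
    ∀ᶠ s in 𝓝 t, ∀ η, φ t a + inner ℝ ξ (η - a) - κ ≤ φ s η := by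
  obtain ⟨c, hc, h⟩ := eventually_add_const_le hcont hconv hsub one_pos
  have h1 : ∀ᶠ s in 𝓝 t, ∀ η ∈ Metric.closedBall a 1, φ t η - κ < φ s η := by
    refine (isCompact_closedBall a 1).eventually_forall_of_forall_eventually fun η _ => ?_
    have hc' : Continuous fun z : ℝ × E => φ z.1 z.2 - φ t z.2 :=
      hcont.sub (hcont.comp (continuous_const.prodMk continuous_snd))
    filter_upwards [(hc'.tendsto (t, η)).eventually_const_lt (u := -κ) (by simp [hκ])] with z hz
    linarith
  filter_upwards [h, h1] with s hs hs1 η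
  rcases le_total 1 ‖η - a‖ with hη | hη
  · have := hs η hη; linarith
  · have := hs1 η (by simpa [dist_eq_norm] using hη)
    have := hsub η
    linarith

end ConvexStability

/-! ### Measurable selection of subgradients by iterated directional derivatives. -/

section MeasurableSubgradient

variable {E : Type*} [NormedAddCommGroup E] [InnerProductSpace ℝ E]

/-- Sublinear functions. -/
structure IsSublinear (p : E → ℝ) : Prop where
  add_le : ∀ x y, p (x + y) ≤ p x + p y
  smul_eq : ∀ (c : ℝ) x, 0 < c → p (c • x) = c * p x

theorem IsSublinear.map_zero {p : E → ℝ} (h : IsSublinear p) : p 0 = 0 := by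
  have := h.smul_eq 2 0 two_pos
  rw [smul_zero] at this
  linarith

/-- The directional derivative at zero of a convex function, as a limit of difference quotients. -/
theorem ConvexOn.exists_sublinear {ψ : E → ℝ} (h : ConvexOn ℝ univ ψ) (h0 : ψ 0 = 0) :
    ∃ p : E → ℝ, IsSublinear p ∧ (∀ η, p η ≤ ψ η) ∧
      ∀ η, Tendsto (fun s : ℝ => s * ψ (s⁻¹ • η)) atTop (𝓝 (p η)) := by
  have hanti : ∀ η, ∀ s s' : ℝ, 0 < s → s ≤ s' → s' * ψ (s'⁻¹ • η) ≤ s * ψ (s⁻¹ • η) := by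
    intro η s s' hs hss
    have hs' : 0 < s' := hs.trans_le hss
    have := h.2 (mem_univ (s⁻¹ • η)) (mem_univ (0 : E)) (div_nonneg hs.le hs'.le)
      (sub_nonneg.2 ((div_le_one hs').2 hss)) (by ring)
    rw [h0, smul_zero, add_zero, smul_smul, smul_eq_mul, smul_eq_mul, mul_zero, add_zero] at this
    have e : s / s' * s⁻¹ = s'⁻¹ := by field_simp
    rw [e] at this
    calc s' * ψ (s'⁻¹ • η) ≤ s' * (s / s' * ψ (s⁻¹ • η)) := by gcongr
      _ = s * ψ (s⁻¹ • η) := by field_simp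
  -- The origin is a convex combination of `s⁻¹ • η` and `-η`, with weights `s / (s + 1)` and `1 /
  -- (s + 1)`.
  have hbdd : ∀ η, ∀ s : ℝ, 0 < s → -ψ (-η) ≤ s * ψ (s⁻¹ • η) := by
    intro η s hs
    have := h.2 (mem_univ (s⁻¹ • η)) (mem_univ (-η)) (div_nonneg hs.le (by linarith : 0 ≤ s + 1))
      (by positivity : 0 ≤ 1 / (s + 1)) (by field_simp)
    have e : (s / (s + 1)) • s⁻¹ • η + (1 / (s + 1)) • (-η) = 0 := by
      rw [smul_smul, smul_neg, ← sub_eq_add_neg, ← sub_smul]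
      have : s / (s + 1) * s⁻¹ - 1 / (s + 1) = 0 := by field_simp; ring
      rw [this, zero_smul]
    rw [e, h0, smul_eq_mul, smul_eq_mul] at this
    have h2 : 0 ≤ (s + 1) * (s / (s + 1) * ψ (s⁻¹ • η) + 1 / (s + 1) * ψ (-η)) := by positivity
    have e2 : (s + 1) * (s / (s + 1) * ψ (s⁻¹ • η) + 1 / (s + 1) * ψ (-η)) =
        s * ψ (s⁻¹ • η) + ψ (-η) := by field_simp
    linarith
  have hlim : ∀ η, ∃ l, Tendsto (fun s : ℝ => s * ψ (s⁻¹ • η)) atTop (𝓝 l) := by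
    intro η
    -- Monotonicity holds only for `s > 0`; clamping at 1 extends it to the whole line without
    -- changing the limit at infinity.
    have hA : Antitone fun s : ℝ => max s 1 * ψ ((max s 1)⁻¹ • η) := fun s s' hss =>
      hanti η _ _ (by positivity) (max_le_max_right _ hss)
    refine ⟨_, (tendsto_atTop_ciInf hA ⟨-ψ (-η), ?_⟩).congr' ?_⟩
    · rintro _ ⟨s, rfl⟩
      exact hbdd η _ (by positivity)
    · filter_upwards [eventually_ge_atTop 1] with s hs
      rw [max_eq_left hs]
  choose p hp using hlim
  refine ⟨p, ⟨fun x y => ?_, fun c x hc => ?_⟩, fun η => ?_, hp⟩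
  · have hx := (hp x).comp (tendsto_id.atTop_div_const (two_pos : (0 : ℝ) < 2))
    have hy := (hp y).comp (tendsto_id.atTop_div_const (two_pos : (0 : ℝ) < 2))
    refine le_of_tendsto_of_tendsto (hp (x + y)) (hx.add hy) ?_
    filter_upwards [eventually_gt_atTop 0] with s hs
    simp only [Function.comp, id]
    have := h.2 (mem_univ ((s / 2)⁻¹ • x)) (mem_univ ((s / 2)⁻¹ • y))
      (by norm_num : (0 : ℝ) ≤ 1 / 2) (by norm_num : (0 : ℝ) ≤ 1 / 2) (by norm_num)
    have e : (1 / 2 : ℝ) • (s / 2)⁻¹ • x + (1 / 2 : ℝ) • (s / 2)⁻¹ • y = s⁻¹ • (x + y) := by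
      rw [smul_smul, smul_smul, smul_add]
      have : (1 / 2 : ℝ) * (s / 2)⁻¹ = s⁻¹ := by field_simp
      rw [this]
    rw [e, smul_eq_mul, smul_eq_mul] at this
    nlinarith
  · have h1 := ((hp x).comp (tendsto_id.atTop_div_const hc)).const_mul c
    refine tendsto_nhds_unique (hp (c • x)) (h1.congr' ?_)
    filter_upwards [eventually_gt_atTop 0] with s hs
    simp only [Function.comp, id, smul_smul]
    have e1 : (s / c)⁻¹ = s⁻¹ * c := by field_simp
    rw [e1]; field_simp
  · refine le_of_tendsto (hp η) ?_
    filter_upwards [eventually_ge_atTop 1] with s hs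
    have := hanti η 1 s one_pos hs
    simpa using this

/-- The directional derivative at `v` of a sublinear function. -/
theorem IsSublinear.exists_dirDeriv {p : E → ℝ} (h : IsSublinear p) (v : E) :
    ∃ p' : E → ℝ, IsSublinear p' ∧ (∀ η, p' η ≤ p η) ∧ p' v + p' (-v) ≤ 0 ∧
      ∀ η, Tendsto (fun s : ℝ => p (s • v + η) - s * p v) atTop (𝓝 (p' η)) := by
  have hlim : ∀ η, ∃ l, Tendsto (fun s : ℝ => p (s • v + η) - s * p v) atTop (𝓝 l) := by
    intro η
    have hA : Antitone fun s : ℝ => p (max s 1 • v + η) - max s 1 * p v := by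
      intro s s' hss
      have h1 : max s 1 ≤ max s' 1 := max_le_max_right _ hss
      rcases h1.eq_or_lt with h2 | h2
      · simp only [h2]; exact le_rfl
      · have h3 := h.add_le ((max s' 1 - max s 1) • v) (max s 1 • v + η)
        rw [h.smul_eq _ _ (sub_pos.2 h2), ← add_assoc, ← add_smul, sub_add_cancel] at h3
        simp only
        linarith
    refine ⟨_, (tendsto_atTop_ciInf hA ⟨-p (-η), ?_⟩).congr' ?_⟩
    · rintro _ ⟨s, rfl⟩
      have h3 := h.add_le (max s 1 • v + η) (-η)
      rw [add_neg_cancel_right, h.smul_eq _ _ (by positivity)] at h3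
      simp only
      linarith
    · filter_upwards [eventually_ge_atTop 1] with s hs
      rw [max_eq_left hs]
  choose p' hp using hlim
  refine ⟨p', ⟨fun x y => ?_, fun c x hc => ?_⟩, fun η => ?_, ?_, hp⟩
  · have hx := (hp x).comp (tendsto_id.atTop_div_const (two_pos : (0 : ℝ) < 2))
    have hy := (hp y).comp (tendsto_id.atTop_div_const (two_pos : (0 : ℝ) < 2))
    refine le_of_tendsto_of_tendsto' (hp (x + y)) (hx.add hy) fun s => ?_
    simp only [Function.comp, id]
    have := h.add_le ((s / 2) • v + x) ((s / 2) • v + y)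
    rw [add_add_add_comm, ← add_smul, add_halves] at this
    linarith
  · have h1 := ((hp x).comp (tendsto_id.atTop_div_const hc)).const_mul c
    refine tendsto_nhds_unique (hp (c • x)) (h1.congr fun s => ?_)
    simp only [Function.comp, id]
    rw [mul_sub, ← h.smul_eq _ _ hc, smul_add, smul_smul]
    have : c * (s / c) = s := by field_simp
    rw [this, ← mul_assoc, this]
  · refine le_of_tendsto (hp η) ?_
    filter_upwards [eventually_gt_atTop 0] with s hs
    have := h.add_le (s • v) η
    rw [h.smul_eq _ _ hs] at this
    linarith
  · have h1 : p' v ≤ p v := by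
      refine le_of_tendsto (hp v) ?_
      filter_upwards [eventually_gt_atTop 0] with s hs
      have := h.add_le (s • v) v
      rw [h.smul_eq _ _ hs] at this
      linarith
    -- By homogeneity the expression under the limit is constant for `s > 1`.
    have h2 : p' (-v) = -p v := by
      refine tendsto_nhds_unique (hp (-v)) (tendsto_const_nhds.congr' ?_)
      filter_upwards [eventually_gt_atTop 1] with s hs
      have : s • v + -v = (s - 1) • v := by rw [sub_smul, one_smul, sub_eq_add_neg]
      rw [this, h.smul_eq _ _ (by linarith)]
      ring
    linarith

variable {X : Type*} [MeasurableSpace X] {μ : Measure X}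

/-- Taking the directional derivative along `v` makes a sublinear function odd on the line of `v`.
Later derivatives only lower the function, so the oddness already gained is kept. Each derivative is
a limit along the integers, so measurability is kept too, which an abstract Hahn–Banach extension
would not give. -/
theorem exists_sublinear_family_antisymm {p : X → E → ℝ} (hm : ∀ η, AEMeasurable (fun x => p x η) μ)
    (hp : ∀ᵐ x ∂μ, IsSublinear (p x)) (l : List E) :
    ∃ q : X → E → ℝ, (∀ η, AEMeasurable (fun x => q x η) μ) ∧
      ∀ᵐ x ∂μ, IsSublinear (q x) ∧ (∀ η, q x η ≤ p x η) ∧ ∀ v ∈ l, q x v + q x (-v) ≤ 0 := by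
  induction l with
  | nil =>
    refine ⟨p, hm, ?_⟩
    filter_upwards [hp] with x hx
    exact ⟨hx, fun η => le_rfl, by simp⟩
  | cons v l ih =>
    obtain ⟨q, hqm, hq⟩ := ih
    have hex : ∀ x, ∃ q' : E → ℝ, IsSublinear (q x) → IsSublinear q' ∧ (∀ η, q' η ≤ q x η) ∧
        q' v + q' (-v) ≤ 0 ∧
        ∀ η, Tendsto (fun s : ℝ => q x (s • v + η) - s * q x v) atTop (𝓝 (q' η)) := by
      intro x
      by_cases hx : IsSublinear (q x)
      · obtain ⟨q', h⟩ := hx.exists_dirDeriv v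
        exact ⟨q', fun _ => h⟩
      · exact ⟨0, fun h => absurd h hx⟩
    choose q' hq' using hex
    refine ⟨q', fun η => ?_, ?_⟩
    · refine aemeasurable_of_tendsto_metrizable_ae (atTop : Filter ℕ)
        (f := fun (n : ℕ) x => q x ((n : ℝ) • v + η) - n * q x v)
        (fun n => (hqm _).sub ((hqm v).const_mul _)) ?_
      filter_upwards [hq] with x hx
      exact ((hq' x hx.1).2.2.2 η).comp tendsto_natCast_atTop_atTop
    · filter_upwards [hq] with x hx
      obtain ⟨h1, h2, h3, -⟩ := hq' x hx.1
      refine ⟨h1, fun η => (h2 η).trans (hx.2.1 η), fun w hw => ?_⟩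
      rcases List.mem_cons.1 hw with rfl | hw
      · exact h3
      · have := hx.2.2 w hw
        linarith [h2 w, h2 (-w)]

/-- **Measurable selection of subgradients** at the origin. -/
theorem exists_measurable_subgradient [FiniteDimensional ℝ E] [MeasurableSpace E] [BorelSpace E]
    {ψ : X → E → ℝ}
    (hm : ∀ η, AEMeasurable (fun x => ψ x η) μ) (hc : ∀ᵐ x ∂μ, ConvexOn ℝ univ (ψ x))
    (h0 : ∀ᵐ x ∂μ, ψ x 0 = 0) :
    ∃ ξ : X → E, Measurable ξ ∧ ∀ᵐ x ∂μ, ∀ η, inner ℝ (ξ x) η ≤ ψ x η := by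
  have hex : ∀ x, ∃ p : E → ℝ, ConvexOn ℝ univ (ψ x) → ψ x 0 = 0 → IsSublinear p ∧
      (∀ η, p η ≤ ψ x η) ∧
      ∀ η, Tendsto (fun s : ℝ => s * ψ x (s⁻¹ • η)) atTop (𝓝 (p η)) := by
    intro x
    by_cases hx : ConvexOn ℝ univ (ψ x) ∧ ψ x 0 = 0
    · obtain ⟨p, h⟩ := hx.1.exists_sublinear hx.2
      exact ⟨p, fun _ _ => h⟩
    · exact ⟨0, fun h h' => absurd ⟨h, h'⟩ hx⟩
  choose p hp using hex
  have hpm : ∀ η, AEMeasurable (fun x => p x η) μ := by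
    intro η
    refine aemeasurable_of_tendsto_metrizable_ae (atTop : Filter ℕ)
      (f := fun (n : ℕ) x => (n : ℝ) * ψ x ((n : ℝ)⁻¹ • η)) (fun n => (hm _).const_mul _) ?_
    filter_upwards [hc, h0] with x hx hx0
    exact ((hp x hx hx0).2.2 η).comp tendsto_natCast_atTop_atTop
  set e := stdOrthonormalBasis ℝ E with he
  obtain ⟨q, hqm, hq⟩ := exists_sublinear_family_antisymm hpm
    (by filter_upwards [hc, h0] with x hx hx0 using (hp x hx hx0).1) (List.ofFn fun i => e i)
  have hξm : AEMeasurable (fun x => ∑ i, q x (e i) • e i) μ := by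
    refine Finset.aemeasurable_fun_sum _ fun i _ => ?_
    exact (hqm (e i)).smul_const _
  refine ⟨hξm.mk _, hξm.measurable_mk, ?_⟩
  filter_upwards [hc, h0, hq, hξm.ae_eq_mk] with x hx hx0 ⟨hq1, hq2, hq3⟩ hmk η
  rw [← hmk]
  -- Being odd along an orthonormal basis, the sublinear `q x` is linear, represented by the vector
  -- of its values on the basis.
  have hanti : ∀ i, q x (-(e i)) = -q x (e i) := by
    intro i
    have h1 := hq3 (e i) (by simp)
    have h2 := hq1.add_le (e i) (-(e i))
    rw [add_neg_cancel, hq1.map_zero] at h2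
    linarith
  have hsm : ∀ i (c : ℝ), q x (c • e i) = c * q x (e i) := by
    intro i c
    rcases lt_trichotomy c 0 with hc | rfl | hc
    · have : c • e i = (-c) • (-(e i)) := by simp
      rw [this, hq1.smul_eq _ _ (neg_pos.2 hc), hanti]; ring
    · simp [hq1.map_zero]
    · exact hq1.smul_eq _ _ hc
  have hle : ∀ η, q x η ≤ inner ℝ (∑ i, q x (e i) • e i) η := by
    intro η
    have hsum : ∀ (s : Finset _), q x (∑ i ∈ s, inner ℝ (e i) η • e i) ≤
        ∑ i ∈ s, q x (inner ℝ (e i) η • e i) := by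
      intro s
      exact Finset.le_sum_of_subadditive _ hq1.map_zero.le hq1.add_le _ _
    have h1 := hsum Finset.univ
    rw [e.sum_repr'] at h1
    refine h1.trans (le_of_eq ?_)
    rw [sum_inner]
    refine Finset.sum_congr rfl fun i _ => ?_
    rw [hsm, inner_smul_left]
    simp [mul_comm]
  -- The upper bound at `-η`, together with `0 ≤ q x η + q x (-η)`, reverses `hle`; the inner
  -- product is thus at most `q x η`, hence at most `ψ x η`.
  have h1 := hle (-η)
  have h2 := hq1.add_le η (-η)
  rw [add_neg_cancel, hq1.map_zero] at h2
  rw [inner_neg_right] at h1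
  have h3 := hq2 η
  have h4 := (hp x hx hx0).2.1 η
  linarith

/-- Superposition of a Carathéodory function with a measurable function. -/
theorem aemeasurable_caratheodory {Z : Type*} [TopologicalSpace Z]
    [TopologicalSpace.PseudoMetrizableSpace Z]
    {g : X → Z → ℝ} (hm : ∀ z, AEMeasurable (fun x => g x z) μ)
    (hc : ∀ᵐ x ∂μ, Continuous (g x)) {w : X → Z} (hw : StronglyMeasurable w) :
    AEMeasurable (fun x => g x (w x)) μ := by
  refine aemeasurable_of_tendsto_metrizable_ae (atTop : Filter ℕ)
    (f := fun (n : ℕ) x => g x (hw.approx n x)) (fun n => ?_) ?_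
  · set s := hw.approx n
    have : (fun x => g x (s x)) =
        fun x => ∑ z ∈ s.range, (s ⁻¹' {z}).indicator (fun x => g x z) x := by
      ext x
      rw [Finset.sum_eq_single_of_mem (s x) (SimpleFunc.mem_range_self s x)]
      · simp
      · intro z _ hz
        simp [hz.symm]
    rw [this]
    exact Finset.aemeasurable_fun_sum _ fun z _ => (hm z).indicator (s.measurableSet_fiber z)
  · filter_upwards [hc] with x hx
    exact (hx.tendsto _).comp (hw.tendsto_approx x)

end MeasurableSubgradient

/-! ### Mollification, translation estimates and local compactness in `L¹`. -/

section LocalCompactness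

variable {N : ℕ}

/-- Mollification of `V` by a normalized bump function. -/
noncomputable def mollify (φ : ContDiffBump (0 : Euc N)) (V : Euc N → ℝ) (x : Euc N) : ℝ :=
  ∫ t, V t * φ.normed volume (x - t)

theorem mollify_eq_convolution (φ : ContDiffBump (0 : Euc N)) (V : Euc N → ℝ) :
    mollify φ V = convolution V (φ.normed volume) (ContinuousLinearMap.mul ℝ ℝ) volume := rfl

theorem mollify_eq_swap (φ : ContDiffBump (0 : Euc N)) (V : Euc N → ℝ) (x : Euc N) :
    mollify φ V x = ∫ z, V (x - z) * φ.normed volume z := by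
  rw [mollify_eq_convolution, convolution_mul_swap]

theorem mollify_eq_convolution_lsmul (φ : ContDiffBump (0 : Euc N)) (V : Euc N → ℝ) :
    mollify φ V = convolution (φ.normed volume) V (ContinuousLinearMap.lsmul ℝ ℝ) volume := by
  ext x
  rw [mollify_eq_swap, convolution_lsmul]
  simp [mul_comm]

theorem contDiff_mollify (φ : ContDiffBump (0 : Euc N)) {V : Euc N → ℝ}
    (hV : LocallyIntegrable V) : ContDiff ℝ 1 (mollify φ V) := by
  rw [mollify_eq_convolution]
  exact φ.hasCompactSupport_normed.contDiff_convolution_right _ hV (φ.contDiff_normed (n := 1))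

theorem integrable_mul_bump (φ : ContDiffBump (0 : Euc N)) {V : Euc N → ℝ}
    (hV : LocallyIntegrable V) (x : Euc N) :
    Integrable fun z => V (x - z) * φ.normed volume z := by
  have := (φ.hasCompactSupport_normed (μ := volume)).convolutionExists_right
    (ContinuousLinearMap.mul ℝ ℝ) hV φ.continuous_normed x
  simpa using this.integrable_swap

theorem lintegral_bump (φ : ContDiffBump (0 : Euc N)) :
    ∫⁻ z, ENNReal.ofReal (φ.normed volume z) = 1 := by
  rw [← ofReal_integral_eq_lintegral_ofReal φ.integrable_normed
    (ae_of_all _ fun z => φ.nonneg_normed z), φ.integral_normed, ENNReal.ofReal_one]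

theorem bump_eq_zero (φ : ContDiffBump (0 : Euc N)) {z : Euc N} (hz : φ.rOut ≤ ‖z‖) :
    φ.normed volume z = 0 := by
  have : z ∉ Function.support (φ.normed volume) := by
    rw [φ.support_normed_eq]; simpa using hz
  simpa using this

/-- The gradient of a mollification is the mollification of the weak gradient. -/
theorem fderiv_mollify (φ : ContDiffBump (0 : Euc N)) {Ω : Set (Euc N)} (hΩ : MeasurableSet Ω)
    {v : Euc N → ℝ} {G : Euc N → Euc N} (hv : LocallyIntegrable (Ω.indicator v))
    (hG : IsWeakGradient Ω v G) {x : Euc N} (hx : Metric.closedBall x φ.rOut ⊆ Ω) (z : Euc N) :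
    fderiv ℝ (mollify φ (Ω.indicator v)) x z =
      ∫ t, inner ℝ (Ω.indicator G t) z * φ.normed volume (x - t) := by
  have hd := (φ.hasCompactSupport_normed (μ := volume)).hasFDerivAt_convolution_right
    (ContinuousLinearMap.mul ℝ ℝ) hv (φ.contDiff_normed (n := 1)) x
  rw [← mollify_eq_convolution] at hd
  rw [hd.fderiv, convolution_precompR_apply _ hv (φ.hasCompactSupport_normed.fderiv ℝ)
    ((φ.contDiff_normed (n := 1)).continuous_fderiv (by simp))]
  rw [convolution_mul]
  set ρ : Euc N → ℝ := φ.normed volume with hρ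
  have hρd : ContDiff ℝ ∞ ρ := φ.contDiff_normed
  have hψ : ContDiff ℝ ∞ fun t => ρ (x - t) := hρd.comp (contDiff_const.sub contDiff_id)
  have hts : tsupport (fun t => ρ (x - t)) ⊆ Metric.closedBall x φ.rOut := by
    refine closure_minimal (fun t ht => ?_) Metric.isClosed_closedBall
    by_contra hc
    refine ht (bump_eq_zero φ ?_)
    simp only [Metric.mem_closedBall, not_le, dist_eq_norm] at hc
    rw [← norm_neg, neg_sub]
    exact hc.le
  have hcs : HasCompactSupport fun t => ρ (x - t) :=
    (isCompact_closedBall x φ.rOut).of_isClosed_subset (isClosed_tsupport _) hts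
  -- The reflected bump `t ↦ ρ (x - t)` is admissible because the closed ball lies in `Ω`.
  -- Reflection changes the sign of the derivative and cancels the sign in the weak gradient.
  have key := hG _ hψ hcs (hts.trans hx) z
  have hf : ∀ t, fderiv ℝ (fun t => ρ (x - t)) t z = -(fderiv ℝ ρ (x - t) z) := by
    intro t
    have h1 : HasFDerivAt (fun t => ρ (x - t))
        ((fderiv ℝ ρ (x - t)).comp (-(ContinuousLinearMap.id ℝ (Euc N)))) t := by
      have h2 : HasFDerivAt ρ (fderiv ℝ ρ (x - t)) (x - t) :=
        (hρd.differentiable (by simp)).differentiableAt.hasFDerivAt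
      exact h2.comp t ((hasFDerivAt_id t).const_sub x)
    rw [h1.fderiv]; simp
  simp only [hf] at key
  have e1 : ∫ t, Ω.indicator v t * fderiv ℝ ρ (x - t) z = ∫ t in Ω, v t * fderiv ℝ ρ (x - t) z := by
    rw [← integral_indicator hΩ]
    congr 1; ext t
    by_cases ht : t ∈ Ω <;> simp [ht]
  have e2 : ∫ t, inner ℝ (Ω.indicator G t) z * ρ (x - t) =
      ∫ t in Ω, inner ℝ (G t) z * ρ (x - t) := by
    rw [← integral_indicator hΩ]
    congr 1; ext t
    by_cases ht : t ∈ Ω <;> simp [ht]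
  rw [e1, e2]
  simp only [mul_neg, integral_neg] at key
  linarith

/-- Translation estimate for mollifications of Sobolev functions. -/
theorem lintegral_translate_mollify_le (φ : ContDiffBump (0 : Euc N)) {Ω : Set (Euc N)}
    (hΩ : MeasurableSet Ω)
    {v : Euc N → ℝ} {G : Euc N → Euc N} (hv : LocallyIntegrable (Ω.indicator v))
    (hGm : Measurable G) (hG : IsWeakGradient Ω v G) {x₀ z : Euc N} {r R : ℝ}
    (hR : Metric.ball x₀ R ⊆ Ω) (hrR : r + ‖z‖ + 2 * φ.rOut ≤ R) :
    ∫⁻ x in Metric.ball x₀ r, ‖mollify φ (Ω.indicator v) (x - z) - mollify φ (Ω.indicator v) x‖ₑ ≤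
      ‖z‖ₑ * ∫⁻ t in Metric.ball x₀ R, ‖Ω.indicator G t‖ₑ := by
  set V := Ω.indicator v with hV
  set W := Ω.indicator G with hW
  have hWm : Measurable W := hGm.indicator hΩ
  have hρm : Measurable (φ.normed (volume : Measure (Euc N))) := φ.continuous_normed.measurable
  -- `‖z‖ₑ * g` dominates the derivative of the mollification in direction `z`. Integrating along
  -- the segment and applying Tonelli twice, the unit mass of the bump leaves only the norm of the
  -- gradient on the larger ball.
  set g : Euc N → ℝ≥0∞ := fun x => ∫⁻ t, ‖W t‖ₑ * ENNReal.ofReal (φ.normed volume (x - t)) with hg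
  have hgm : Measurable g := by
    refine Measurable.lintegral_prod_right' (f := fun p : Euc N × Euc N =>
      ‖W p.2‖ₑ * ENNReal.ofReal (φ.normed volume (p.1 - p.2))) ?_
    exact (hWm.comp measurable_snd).enorm.mul
      (hρm.comp (measurable_fst.sub measurable_snd)).ennreal_ofReal
  have hV1 := contDiff_mollify φ hv
  have hD : ∀ x, x ∈ Metric.ball x₀ (r + ‖z‖) → ‖fderiv ℝ (mollify φ V) x z‖ₑ ≤ ‖z‖ₑ * g x := by
    intro x hx
    have hsub : Metric.closedBall x φ.rOut ⊆ Ω := by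
      refine (Metric.closedBall_subset_ball' ?_).trans hR
      have := φ.rOut_pos
      rw [Metric.mem_ball] at hx
      linarith
    rw [fderiv_mollify φ hΩ hv hG hsub]
    refine (enorm_integral_le_lintegral_enorm _).trans ?_
    rw [hg, ← lintegral_const_mul' _ _ enorm_ne_top]
    refine lintegral_mono fun t => ?_
    rw [enorm_mul, Real.enorm_of_nonneg (φ.nonneg_normed _), ← mul_assoc, mul_comm ‖z‖ₑ]
    gcongr
    rw [← ofReal_norm, ← ofReal_norm, ← ofReal_norm, ← ENNReal.ofReal_mul (norm_nonneg _)]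
    exact ENNReal.ofReal_le_ofReal (norm_inner_le_norm _ _)
  have hpt : ∀ x ∈ Metric.ball x₀ r, ‖mollify φ V (x - z) - mollify φ V x‖ₑ ≤
      ‖z‖ₑ * ∫⁻ s in Icc (0 : ℝ) 1, g (x - s • z) := by
    intro x hx
    have hline : ContDiff ℝ 1 fun s : ℝ => mollify φ V (x - s • z) :=
      hV1.comp (contDiff_const.sub (contDiff_id.smul contDiff_const))
    have h1 := enorm_sub_le_lintegral_deriv_of_contDiffOn_Icc hline.contDiffOn zero_le_one
    simp only [one_smul, zero_smul, sub_zero] at h1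
    refine h1.trans ?_
    rw [← lintegral_const_mul' _ _ enorm_ne_top]
    refine setLIntegral_mono' measurableSet_Icc fun s hs => ?_
    have hder : deriv (fun s : ℝ => mollify φ V (x - s • z)) s =
        -(fderiv ℝ (mollify φ V) (x - s • z) z) := by
      have h2 : HasFDerivAt (mollify φ V) (fderiv ℝ (mollify φ V) (x - s • z)) (x - s • z) :=
        (hV1.differentiable (by simp)).differentiableAt.hasFDerivAt
      have h3 : HasDerivAt (fun s : ℝ => x - s • z) (-((1 : ℝ) • z)) s :=
        ((hasDerivAt_id s).smul_const z).const_sub x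
      have := (h2.comp_hasDerivAt s h3).deriv
      rw [Function.comp_def] at this
      rw [this]; simp
    rw [hder, enorm_neg]
    refine hD _ ?_
    rw [Metric.mem_ball, dist_eq_norm] at hx ⊢
    have : ‖s • z‖ ≤ ‖z‖ := by
      rw [norm_smul, Real.norm_of_nonneg hs.1]
      exact mul_le_of_le_one_left (norm_nonneg _) hs.2
    calc ‖x - s • z - x₀‖ = ‖(x - x₀) - s • z‖ := by congr 1; abel
      _ ≤ ‖x - x₀‖ + ‖s • z‖ := norm_sub_le _ _
      _ < r + ‖z‖ := by linarith
  calc _ ≤ ∫⁻ x in Metric.ball x₀ r, ‖z‖ₑ * ∫⁻ s in Icc (0 : ℝ) 1, g (x - s • z) :=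
        setLIntegral_mono' measurableSet_ball hpt
    _ = ‖z‖ₑ * ∫⁻ x in Metric.ball x₀ r, ∫⁻ s in Icc (0 : ℝ) 1, g (x - s • z) :=
        lintegral_const_mul' _ _ enorm_ne_top
    _ = ‖z‖ₑ * ∫⁻ s in Icc (0 : ℝ) 1, ∫⁻ x in Metric.ball x₀ r, g (x - s • z) := by
        rw [lintegral_lintegral_swap]
        refine (hgm.comp ?_).aemeasurable
        exact measurable_fst.sub (measurable_snd.smul_const z)
    _ ≤ ‖z‖ₑ * ∫⁻ s in Icc (0 : ℝ) 1, ∫⁻ x in Metric.ball x₀ (r + ‖z‖), g x := by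
        gcongr ‖z‖ₑ * ?_
        refine setLIntegral_mono' measurableSet_Icc fun s hs => ?_
        rw [← lintegral_indicator measurableSet_ball, ← lintegral_indicator measurableSet_ball,
          ← lintegral_sub_right_eq_self ((Metric.ball x₀ (r + ‖z‖)).indicator g) (s • z)]
        refine lintegral_mono fun x => ?_
        by_cases hx : x ∈ Metric.ball x₀ r
        · have hx' : x - s • z ∈ Metric.ball x₀ (r + ‖z‖) := by
            rw [Metric.mem_ball, dist_eq_norm] at hx ⊢
            have : ‖s • z‖ ≤ ‖z‖ := by
              rw [norm_smul, Real.norm_of_nonneg hs.1]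
              exact mul_le_of_le_one_left (norm_nonneg _) hs.2
            calc ‖x - s • z - x₀‖ = ‖(x - x₀) - s • z‖ := by congr 1; abel
              _ ≤ ‖x - x₀‖ + ‖s • z‖ := norm_sub_le _ _
              _ < r + ‖z‖ := by linarith
          rw [indicator_of_mem hx, indicator_of_mem hx']
        · rw [indicator_of_notMem hx]; exact zero_le
    _ = ‖z‖ₑ * ∫⁻ x in Metric.ball x₀ (r + ‖z‖), g x := by simp
    _ = ‖z‖ₑ * ∫⁻ t, ∫⁻ x in Metric.ball x₀ (r + ‖z‖),
          ‖W t‖ₑ * ENNReal.ofReal (φ.normed volume (x - t)) := by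
        rw [hg, lintegral_lintegral_swap]
        refine Measurable.aemeasurable ?_
        exact (hWm.comp measurable_snd).enorm.mul
          (hρm.comp (measurable_fst.sub measurable_snd)).ennreal_ofReal
    _ ≤ ‖z‖ₑ * ∫⁻ t, (Metric.ball x₀ R).indicator (fun t => ‖W t‖ₑ) t := by
        gcongr ‖z‖ₑ * ?_
        refine lintegral_mono fun t => ?_
        by_cases ht : t ∈ Metric.ball x₀ R
        · rw [indicator_of_mem ht, lintegral_const_mul' _ _ enorm_ne_top]
          calc _ ≤ ‖W t‖ₑ * ∫⁻ x, ENNReal.ofReal (φ.normed volume (x - t)) := by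
                gcongr; exact Measure.restrict_le_self
            _ = ‖W t‖ₑ := by
                rw [lintegral_sub_right_eq_self (fun y => ENNReal.ofReal (φ.normed volume y)) t,
                  lintegral_bump, mul_one]
        · rw [indicator_of_notMem ht, nonpos_iff_eq_zero,
            setLIntegral_congr_fun (g := fun _ => 0) measurableSet_ball]
          · simp
          intro x hx
          simp only
          rw [bump_eq_zero φ, ENNReal.ofReal_zero, mul_zero]
          rw [Metric.mem_ball, dist_eq_norm] at hx ht
          have := φ.rOut_pos
          have h3 : ‖t - x₀‖ ≤ ‖x - x₀‖ + ‖x - t‖ := by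
            have : t - x₀ = (x - x₀) - (x - t) := by abel
            rw [this]; exact norm_sub_le _ _
          linarith
    _ = _ := by rw [lintegral_indicator measurableSet_ball]

/-- Translation estimate for Sobolev functions. -/
theorem lintegral_translate_le {Ω : Set (Euc N)} (hΩ : MeasurableSet Ω)
    {v : Euc N → ℝ} {G : Euc N → Euc N} (hv : LocallyIntegrable (Ω.indicator v))
    (hGm : Measurable G) (hG : IsWeakGradient Ω v G) {x₀ z : Euc N} {r R : ℝ}
    (hR : Metric.ball x₀ R ⊆ Ω) (hrR : r + ‖z‖ < R) :
    ∫⁻ x in Metric.ball x₀ r, ‖Ω.indicator v (x - z) - Ω.indicator v x‖ₑ ≤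
      ‖z‖ₑ * ∫⁻ t in Metric.ball x₀ R, ‖Ω.indicator G t‖ₑ := by
  set V := Ω.indicator v with hV
  -- The ratio of outer to inner radius is kept equal to 2, since a.e. convergence of mollifications
  -- needs it bounded. Fatou's lemma then removes the mollification from the estimate.
  let φ : ℕ → ContDiffBump (0 : Euc N) := fun n =>
    ⟨1 / ((n : ℝ) + 1), 2 * (1 / ((n : ℝ) + 1)), by positivity, by
      have : 0 < 1 / ((n : ℝ) + 1) := by positivity
      linarith⟩
  have hφ : Tendsto (fun n => (φ n).rOut) atTop (𝓝 0) := by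
    have := (tendsto_one_div_add_atTop_nhds_zero_nat (𝕜 := ℝ)).const_mul 2
    rwa [mul_zero] at this
  have hae : ∀ᵐ x, Tendsto (fun n => mollify (φ n) V x) atTop (𝓝 (V x)) := by
    have := ContDiffBump.ae_convolution_tendsto_right_of_locallyIntegrable (φ := φ) (K := 2)
      hφ (Eventually.of_forall fun n => le_rfl) hv
    simpa only [← mollify_eq_convolution_lsmul] using this
  have hae' : ∀ᵐ x, Tendsto (fun n => mollify (φ n) V (x - z)) atTop (𝓝 (V (x - z))) :=
    (measurePreserving_sub_right volume z).quasiMeasurePreserving.ae hae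
  calc ∫⁻ x in Metric.ball x₀ r, ‖V (x - z) - V x‖ₑ
      = ∫⁻ x in Metric.ball x₀ r,
          liminf (fun n => ‖mollify (φ n) V (x - z) - mollify (φ n) V x‖ₑ) atTop := by
        refine lintegral_congr_ae ?_
        filter_upwards [ae_restrict_of_ae hae, ae_restrict_of_ae hae'] with x h1 h2
        exact ((h2.sub h1).enorm.liminf_eq).symm
    _ ≤ liminf (fun n => ∫⁻ x in Metric.ball x₀ r,
          ‖mollify (φ n) V (x - z) - mollify (φ n) V x‖ₑ) atTop := by
        refine lintegral_liminf_le fun n => ?_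
        have hc := (contDiff_mollify (φ n) hv).continuous
        exact ((hc.comp (continuous_id.sub continuous_const)).sub hc).measurable.enorm
    _ ≤ _ := by
        refine liminf_le_of_frequently_le' (Eventually.frequently ?_)
        have h3 := (hφ.const_mul 2).eventually_lt_const (u := R - (r + ‖z‖)) (by linarith)
        filter_upwards [h3] with n hn
        exact lintegral_translate_mollify_le (φ n) hΩ hv hGm hG hR (by linarith)

/-- Rate of convergence of mollifications of Sobolev functions. -/
theorem lintegral_sub_mollify_le (φ : ContDiffBump (0 : Euc N)) {Ω : Set (Euc N)}
    (hΩ : MeasurableSet Ω) {v : Euc N → ℝ} {G : Euc N → Euc N}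
    (hv : LocallyIntegrable (Ω.indicator v)) (hvm : Measurable v)
    (hGm : Measurable G) (hG : IsWeakGradient Ω v G) {x₀ : Euc N} {r R : ℝ}
    (hR : Metric.ball x₀ R ⊆ Ω) (hrR : r + φ.rOut < R) :
    ∫⁻ x in Metric.ball x₀ r, ‖Ω.indicator v x - mollify φ (Ω.indicator v) x‖ₑ ≤
      ENNReal.ofReal φ.rOut * ∫⁻ t in Metric.ball x₀ R, ‖Ω.indicator G t‖ₑ := by
  set V := Ω.indicator v with hV
  have hVm : Measurable V := hvm.indicator hΩ
  have hρm : Measurable (φ.normed (volume : Measure (Euc N))) := φ.continuous_normed.measurable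
  have hpt : ∀ x, ‖V x - mollify φ V x‖ₑ ≤
      ∫⁻ z, ‖V (x - z) - V x‖ₑ * ENNReal.ofReal (φ.normed volume z) := by
    intro x
    have e : V x - mollify φ V x = ∫ z, (V x - V (x - z)) * φ.normed volume z := by
      simp_rw [sub_mul]
      rw [integral_sub (φ.integrable_normed.const_mul _) (integrable_mul_bump φ hv x),
        integral_const_mul, φ.integral_normed, mul_one, mollify_eq_swap]
    rw [e]
    refine (enorm_integral_le_lintegral_enorm _).trans (le_of_eq ?_)
    congr 1; ext z
    rw [enorm_mul, Real.enorm_of_nonneg (φ.nonneg_normed _), ← enorm_neg, neg_sub]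
  calc _ ≤ ∫⁻ x in Metric.ball x₀ r,
          ∫⁻ z, ‖V (x - z) - V x‖ₑ * ENNReal.ofReal (φ.normed volume z) := lintegral_mono hpt
    _ = ∫⁻ z, ∫⁻ x in Metric.ball x₀ r,
          ‖V (x - z) - V x‖ₑ * ENNReal.ofReal (φ.normed volume z) := by
        rw [lintegral_lintegral_swap]
        refine Measurable.aemeasurable ?_
        exact ((hVm.comp (measurable_fst.sub measurable_snd)).sub (hVm.comp measurable_fst)).enorm.mul
          (hρm.comp measurable_snd).ennreal_ofReal
    _ ≤ ∫⁻ z, (ENNReal.ofReal φ.rOut * ∫⁻ t in Metric.ball x₀ R, ‖Ω.indicator G t‖ₑ) *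
          ENNReal.ofReal (φ.normed volume z) := by
        refine lintegral_mono fun z => ?_
        simp only
        rw [lintegral_mul_const' _ _ ENNReal.ofReal_ne_top]
        rcases le_total φ.rOut ‖z‖ with hz | hz
        · rw [bump_eq_zero φ hz]; simp
        · gcongr
          refine (lintegral_translate_le hΩ hv hGm hG hR (by linarith)).trans ?_
          gcongr
          rw [← ofReal_norm]
          exact ENNReal.ofReal_le_ofReal hz
    _ = _ := by
        rw [lintegral_const_mul _ hρm.ennreal_ofReal, lintegral_bump, mul_one]

/-- **Local compactness of the Sobolev embedding into `L¹`.** -/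
theorem tendsto_lintegral_ball_of_weak {Ω : Set (Euc N)}
    (hΩ : MeasurableSet Ω) {v : ℕ → Euc N → ℝ} {G : ℕ → Euc N → Euc N}
    (hv : ∀ n, LocallyIntegrable (Ω.indicator (v n))) (hvm : ∀ n, Measurable (v n))
    (hGm : ∀ n, Measurable (G n)) (hG : ∀ n, IsWeakGradient Ω (v n) (G n)) {x₀ : Euc N} {r R : ℝ}
    (hrR : r < R) (hR : Metric.ball x₀ R ⊆ Ω) {M : ℝ≥0∞} (hM : M ≠ ⊤)
    (hMv : ∀ n, ∫⁻ t in Metric.ball x₀ R, ‖Ω.indicator (v n) t‖ₑ ≤ M)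
    (hMG : ∀ n, ∫⁻ t in Metric.ball x₀ R, ‖Ω.indicator (G n) t‖ₑ ≤ M)
    (hw : ∀ (φ : ContDiffBump (0 : Euc N)) (x : Euc N),
      Tendsto (fun n => mollify φ (Ω.indicator (v n)) x) atTop (𝓝 0)) :
    Tendsto (fun n => ∫⁻ x in Metric.ball x₀ r, ‖Ω.indicator (v n) x‖ₑ) atTop (𝓝 0) := by
  rw [ENNReal.tendsto_nhds_zero]
  intro ε hε
  have hε2 : 0 < ε / 2 := ENNReal.half_pos hε.ne'
  obtain ⟨δ, hδ0, hδ⟩ : ∃ δ : ℝ, 0 < δ ∧ ENNReal.ofReal δ * M ≤ ε / 2 := by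
    have h1 : Tendsto (fun δ : ℝ => ENNReal.ofReal δ * M) (𝓝 0) (𝓝 (ENNReal.ofReal 0 * M)) :=
      ENNReal.Tendsto.mul_const (ENNReal.tendsto_ofReal tendsto_id) (Or.inr hM)
    rw [ENNReal.ofReal_zero, zero_mul] at h1
    have h2 := (ENNReal.tendsto_nhds_zero.1 h1 _ hε2)
    have h3 : ∀ᶠ δ in 𝓝[>] (0 : ℝ), ENNReal.ofReal δ * M ≤ ε / 2 := h2.filter_mono nhdsWithin_le_nhds
    obtain ⟨δ, h4, h5⟩ := (h3.and self_mem_nhdsWithin).exists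
    exact ⟨δ, h5, h4⟩
  -- The radius `η` is small enough that the mollification error is at most `ε / 2` for all `n`, and
  -- that bumps centred in the small ball stay in the large one.
  set η := min δ ((R - r) / 2) with hη
  have hη0 : 0 < η := lt_min hδ0 (by linarith)
  have hη1 : η ≤ (R - r) / 2 := min_le_right _ _
  let φ : ContDiffBump (0 : Euc N) := ⟨η / 2, η, by positivity, by linarith⟩
  have hφ : φ.rOut = η := rfl
  -- With the bump fixed, its supremum times the `L¹` bound dominates all mollifications, so their
  -- pointwise convergence suffices.
  obtain ⟨K, hK⟩ : ∃ K : ℝ, ∀ z, φ.normed volume z ≤ K :=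
    ⟨_, fun z => φ.normed_le_div_measure_closedBall_rIn (μ := volume) z⟩
  have hpt : ∀ n, ∀ x ∈ Metric.ball x₀ r, ‖mollify φ (Ω.indicator (v n)) x‖ₑ ≤
      ENNReal.ofReal K * M := by
    intro n x hx
    rw [mollify]
    refine (enorm_integral_le_lintegral_enorm _).trans ?_
    calc _ ≤ ∫⁻ t, (Metric.ball x₀ R).indicator
          (fun t => ENNReal.ofReal K * ‖Ω.indicator (v n) t‖ₑ) t := by
          refine lintegral_mono fun t => ?_
          rw [enorm_mul, Real.enorm_of_nonneg (φ.nonneg_normed _)]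
          by_cases ht : t ∈ Metric.ball x₀ R
          · rw [indicator_of_mem ht, mul_comm]
            gcongr
            exact hK _
          · rw [bump_eq_zero φ]
            · simp
            rw [Metric.mem_ball, dist_eq_norm] at hx ht
            have h3 : ‖t - x₀‖ ≤ ‖x - x₀‖ + ‖x - t‖ := by
              have : t - x₀ = (x - x₀) - (x - t) := by abel
              rw [this]; exact norm_sub_le _ _
            linarith
      _ = ENNReal.ofReal K * ∫⁻ t in Metric.ball x₀ R, ‖Ω.indicator (v n) t‖ₑ := by
          rw [lintegral_indicator measurableSet_ball, lintegral_const_mul' _ _ ENNReal.ofReal_ne_top]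
      _ ≤ _ := by gcongr; exact hMv n
  have hlim : Tendsto (fun n => ∫⁻ x in Metric.ball x₀ r, ‖mollify φ (Ω.indicator (v n)) x‖ₑ)
      atTop (𝓝 0) := by
    have := tendsto_lintegral_of_dominated_convergence (μ := volume.restrict (Metric.ball x₀ r))
      (F := fun n x => ‖mollify φ (Ω.indicator (v n)) x‖ₑ) (f := fun _ => 0)
      (fun _ => ENNReal.ofReal K * M)
      (fun n => (contDiff_mollify φ (hv n)).continuous.measurable.enorm)
      (fun n => by
        filter_upwards [ae_restrict_mem measurableSet_ball] with x hx using hpt n x hx)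
      (by
        rw [lintegral_const, Measure.restrict_apply_univ]
        exact ENNReal.mul_ne_top (ENNReal.mul_ne_top ENNReal.ofReal_ne_top hM)
          measure_ball_lt_top.ne)
      (ae_of_all _ fun x => by simpa using (hw φ x).enorm)
    simpa using this
  filter_upwards [ENNReal.tendsto_nhds_zero.1 hlim (ε / 2) hε2] with n hn
  have hVm : Measurable (Ω.indicator (v n)) := (hvm n).indicator hΩ
  have hcm : Measurable (mollify φ (Ω.indicator (v n))) :=
    (contDiff_mollify φ (hv n)).continuous.measurable
  calc ∫⁻ x in Metric.ball x₀ r, ‖Ω.indicator (v n) x‖ₑ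
      ≤ ∫⁻ x in Metric.ball x₀ r, (‖Ω.indicator (v n) x - mollify φ (Ω.indicator (v n)) x‖ₑ +
          ‖mollify φ (Ω.indicator (v n)) x‖ₑ) := by
        refine lintegral_mono fun x => ?_
        simpa using enorm_add_le (Ω.indicator (v n) x - mollify φ (Ω.indicator (v n)) x)
          (mollify φ (Ω.indicator (v n)) x)
    _ = (∫⁻ x in Metric.ball x₀ r, ‖Ω.indicator (v n) x - mollify φ (Ω.indicator (v n)) x‖ₑ) +
          ∫⁻ x in Metric.ball x₀ r, ‖mollify φ (Ω.indicator (v n)) x‖ₑ :=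
        lintegral_add_right _ hcm.enorm
    _ ≤ ε / 2 + ε / 2 := by
        refine add_le_add ?_ hn
        refine (lintegral_sub_mollify_le φ hΩ (hv n) (hvm n) (hGm n) (hG n) hR
          (by linarith)).trans (le_trans ?_ hδ)
        rw [hφ]
        gcongr
        · exact min_le_left _ _
        · exact hMG n
    _ = ε := ENNReal.add_halves ε

end LocalCompactness

/-! ### From weak convergence in the Sobolev space to a.e. convergence of a subsequence. -/

section WeakConvergence

theorem exists_subseq_ae_of_setLIntegral_cover {X E : Type*} [MeasurableSpace X] {μ : Measure X}
    [SigmaFinite μ] [NormedAddCommGroup E]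
    {g : ℕ → X → E} (hg : ∀ n, AEStronglyMeasurable (g n) μ) {B : ℕ → Set X}
    (hB : ∀ k, MeasurableSet (B k)) (hun : ∀ᵐ x ∂μ, x ∈ ⋃ k, B k)
    (h : ∀ k, Tendsto (fun n => ∫⁻ x in B k, ‖g n x‖ₑ ∂μ) atTop (𝓝 0)) :
    ∃ s : ℕ → ℕ, StrictMono s ∧ ∀ᵐ x ∂μ, Tendsto (fun n => g (s n) x) atTop (𝓝 0) := by
  refine exists_subseq_ae_of_setLIntegral (A := accumulate B) hg
    (fun k => MeasurableSet.biUnion (to_countable _) fun i _ => hB i) monotone_accumulate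
    (by rwa [iUnion_accumulate]) fun k => ?_
  induction k with
  | zero => simpa using h 0
  | succ k ih =>
    refine tendsto_of_tendsto_of_tendsto_of_le_of_le tendsto_const_nhds
      (by simpa using ih.add (h (k + 1))) (fun n => zero_le) fun n => ?_
    rw [accumulate_succ]
    exact lintegral_union_le _ _ _

/-- Uniform boundedness in the bidual: the dual is complete even if `X` is not, and the embedding of
`X` is isometric. -/
theorem WeaklyConvergesTo.exists_norm_le {X : Type*} [NormedAddCommGroup X] [NormedSpace ℝ X]
    {x : ℕ → X} {a : X} (h : WeaklyConvergesTo x a) : ∃ M, ∀ n, ‖x n‖ ≤ M := by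
  obtain ⟨M, hM⟩ := banach_steinhaus (g := fun n => NormedSpace.inclusionInDoubleDual ℝ X (x n))
    (fun ℓ => by
      obtain ⟨C, hC⟩ := (h ℓ).norm.bddAbove_range
      exact ⟨C, fun n => hC ⟨n, rfl⟩⟩)
  refine ⟨M, fun n => ?_⟩
  rw [← (NormedSpace.inclusionInDoubleDualLi ℝ (E := X)).norm_map]
  exact hM n

theorem WeaklyConvergesTo.comp {X : Type*} [NormedAddCommGroup X] [NormedSpace ℝ X]
    {x : ℕ → X} {a : X} (h : WeaklyConvergesTo x a) {s : ℕ → ℕ} (hs : Tendsto s atTop atTop) :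
    WeaklyConvergesTo (fun n => x (s n)) a :=
  fun ℓ => (h ℓ).comp hs

theorem WeaklyConvergesTo.sub_self {X : Type*} [NormedAddCommGroup X] [NormedSpace ℝ X]
    {x : ℕ → X} {a : X} (h : WeaklyConvergesTo x a) : WeaklyConvergesTo (fun n => x n - a) 0 := by
  intro ℓ
  simpa using (h ℓ).sub_const (ℓ a)

theorem memLp_of_bounded_support {X F : Type*} [MeasurableSpace X] {μ : Measure X}
    [NormedAddCommGroup F]
    {ψ : X → F} (hψ : AEStronglyMeasurable ψ μ) {A : Set X} (hA : MeasurableSet A) (hf : μ A ≠ ⊤)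
    {M : ℝ} (hM : ∀ x, ‖ψ x‖ ≤ M) (h0 : ∀ x ∉ A, ψ x = 0) (p : ℝ≥0∞) : MemLp ψ p μ := by
  refine (memLp_indicator_const p hA M (Or.inr hf)).mono' hψ (ae_of_all _ fun x => ?_)
  by_cases hx : x ∈ A
  · simpa [hx] using hM x
  · simp [hx, h0 x hx]

variable {N : ℕ} {p : ℝ≥0∞} [Fact (1 ≤ p)] {Ω : Set (Euc N)}

/-- Pairing with `ψ`, composed with the projection from pairs `(u, Du)`, is a continuous functional
on the Sobolev space. -/
theorem tendsto_integral_sobFun {u : ℕ → SobolevW p Ω} {w : SobolevW p Ω}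
    (h : WeaklyConvergesTo u w) {ψ : Euc N → ℝ} (hψ : MemLp ψ p.conjExponent (lebOn Ω)) :
    Tendsto (fun n => ∫ x in Ω, ψ x * sobFun (u n) x) atTop (𝓝 (∫ x in Ω, ψ x * sobFun w x)) := by
  have : Fact (1 ≤ p.conjExponent) := ⟨ENNReal.HolderConjugate.one_le p.conjExponent p⟩
  have key := h (((ContinuousLinearMap.mul ℝ ℝ).lpPairing (lebOn Ω) p.conjExponent p
    hψ.toLp).comp ((ContinuousLinearMap.fst ℝ (Lp ℝ p (lebOn Ω)) (Lp (Euc N) p (lebOn Ω))).comp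
      (SobolevW p Ω).subtypeL))
  have e : ∀ z : SobolevW p Ω, ((ContinuousLinearMap.mul ℝ ℝ).lpPairing (lebOn Ω) p.conjExponent p
      hψ.toLp) z.1.1 = ∫ x in Ω, ψ x * sobFun z x := by
    intro z
    rw [ContinuousLinearMap.lpPairing_eq_integral]
    refine integral_congr_ae ?_
    filter_upwards [hψ.coeFn_toLp] with x hx
    rw [hx]; rfl
  simpa only [ContinuousLinearMap.comp_apply, Submodule.subtypeL_apply,
    ContinuousLinearMap.coe_fst', e] using key

theorem tendsto_integral_sobGrad {u : ℕ → SobolevW p Ω} {w : SobolevW p Ω}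
    (h : WeaklyConvergesTo u w) {ψ : Euc N → Euc N} (hψ : MemLp ψ p.conjExponent (lebOn Ω)) :
    Tendsto (fun n => ∫ x in Ω, inner ℝ (ψ x) (sobGrad (u n) x)) atTop
      (𝓝 (∫ x in Ω, inner ℝ (ψ x) (sobGrad w x))) := by
  have : Fact (1 ≤ p.conjExponent) := ⟨ENNReal.HolderConjugate.one_le p.conjExponent p⟩
  have key := h (((innerSL ℝ (E := Euc N)).lpPairing (lebOn Ω) p.conjExponent p
    hψ.toLp).comp ((ContinuousLinearMap.snd ℝ (Lp ℝ p (lebOn Ω)) (Lp (Euc N) p (lebOn Ω))).comp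
      (SobolevW p Ω).subtypeL))
  have e : ∀ z : SobolevW p Ω, ((innerSL ℝ (E := Euc N)).lpPairing (lebOn Ω) p.conjExponent p
      hψ.toLp) z.1.2 = ∫ x in Ω, inner ℝ (ψ x) (sobGrad z x) := by
    intro z
    rw [ContinuousLinearMap.lpPairing_eq_integral]
    refine integral_congr_ae ?_
    filter_upwards [hψ.coeFn_toLp] with x hx
    rw [hx]; rfl
  simpa only [ContinuousLinearMap.comp_apply, Submodule.subtypeL_apply,
    ContinuousLinearMap.coe_snd', e] using key

theorem stronglyMeasurable_sobFun (z : SobolevW p Ω) : StronglyMeasurable (sobFun z) :=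
  Lp.stronglyMeasurable _

theorem stronglyMeasurable_sobGrad (z : SobolevW p Ω) : StronglyMeasurable (sobGrad z) :=
  Lp.stronglyMeasurable _

theorem memLp_sobFun (z : SobolevW p Ω) : MemLp (sobFun z) p (lebOn Ω) := Lp.memLp _

theorem memLp_sobGrad (z : SobolevW p Ω) : MemLp (sobGrad z) p (lebOn Ω) := Lp.memLp _

theorem eLpNorm_sobFun_le (z : SobolevW p Ω) : eLpNorm (sobFun z) p (lebOn Ω) ≤ ‖z‖ₑ := by
  rw [sobFun, ← Lp.enorm_def, ← ofReal_norm, ← ofReal_norm]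
  exact ENNReal.ofReal_le_ofReal (norm_fst_le z.1)

theorem eLpNorm_sobGrad_le (z : SobolevW p Ω) : eLpNorm (sobGrad z) p (lebOn Ω) ≤ ‖z‖ₑ := by
  rw [sobGrad, ← Lp.enorm_def, ← ofReal_norm, ← ofReal_norm]
  exact ENNReal.ofReal_le_ofReal (norm_snd_le z.1)

theorem sobFun_sub (z z' : SobolevW p Ω) :
    ∀ᵐ x ∂(lebOn Ω), sobFun (z - z') x = sobFun z x - sobFun z' x :=
  Lp.coeFn_sub z.1.1 z'.1.1

theorem setLIntegral_ball_le {F : Type*} [NormedAddCommGroup F] {f : Euc N → F}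
    (hΩ : MeasurableSet Ω) (hf : AEStronglyMeasurable f (lebOn Ω)) (x₀ : Euc N) (R : ℝ) :
    ∫⁻ t in Metric.ball x₀ R, ‖Ω.indicator f t‖ₑ ≤ eLpNorm f p (lebOn Ω) *
      volume (Metric.ball x₀ R) ^ (1 - 1 / p.toReal) := by
  have h1p : 1 ≤ p := Fact.out
  have e : ∫⁻ t in Metric.ball x₀ R, ‖Ω.indicator f t‖ₑ =
      eLpNorm f 1 ((lebOn Ω).restrict (Metric.ball x₀ R)) := by
    rw [eLpNorm_one_eq_lintegral_enorm, Measure.restrict_restrict measurableSet_ball, inter_comm,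
      ← Measure.restrict_restrict hΩ, ← lintegral_indicator hΩ]
    congr 1; ext t
    by_cases ht : t ∈ Ω <;> simp [ht]
  rw [e]
  have h2 := eLpNorm_le_eLpNorm_mul_rpow_measure_univ h1p
    (hf.restrict (s := Metric.ball x₀ R))
  refine h2.trans ?_
  rw [Measure.restrict_apply_univ, ENNReal.toReal_one, div_one]
  refine mul_le_mul' (eLpNorm_mono_measure _ Measure.restrict_le_self)
    (ENNReal.rpow_le_rpow (Measure.restrict_apply_le _ _) ?_)
  -- For `p = ⊤` the conventions `toReal ⊤ = 0` and `1 / 0 = 0` give the correct exponent 1.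
  rcases eq_or_ne p ⊤ with rfl | hp
  · simp
  have : 1 ≤ p.toReal := by simpa using ENNReal.toReal_mono hp h1p
  rw [sub_nonneg]
  exact (div_le_one (by linarith)).2 this

theorem locallyIntegrable_indicator_sobFun (hΩ : MeasurableSet Ω) (z : SobolevW p Ω) :
    LocallyIntegrable (Ω.indicator (sobFun z)) := by
  have : MemLp (Ω.indicator (sobFun z)) p volume := (memLp_indicator_iff_restrict hΩ).2 (memLp_sobFun z)
  exact this.locallyIntegrable Fact.out

/-- The value of a mollification at a fixed point is the pairing with a fixed bounded function of
compact support, so weak convergence acts pointwise. -/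
theorem tendsto_mollify_of_weak (hΩ : MeasurableSet Ω) {z : ℕ → SobolevW p Ω}
    (h : WeaklyConvergesTo z 0) (φ : ContDiffBump (0 : Euc N)) (x : Euc N) :
    Tendsto (fun n => mollify φ (Ω.indicator (sobFun (z n))) x) atTop (𝓝 0) := by
  have hc : Continuous fun t => φ.normed volume (x - t) :=
    φ.continuous_normed.comp (continuous_const.sub continuous_id)
  have hψ : MemLp (fun t => φ.normed volume (x - t)) p.conjExponent (lebOn Ω) := by
    refine memLp_of_bounded_support hc.aestronglyMeasurable
      (measurableSet_closedBall (x := x) (ε := φ.rOut))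
      (ne_top_of_le_ne_top (isCompact_closedBall x φ.rOut).measure_lt_top.ne
        (Measure.restrict_apply_le _ _)) 
      (M := 1 / volume.real (Metric.closedBall (0 : Euc N) φ.rIn))
      (fun t => ?_) (fun t ht => ?_) _
    · rw [Real.norm_of_nonneg (φ.nonneg_normed _)]
      exact φ.normed_le_div_measure_closedBall_rIn (μ := volume) _
    · refine bump_eq_zero φ ?_
      rw [Metric.mem_closedBall, dist_eq_norm, not_le, ← norm_neg, neg_sub] at ht
      exact ht.le
  have key := tendsto_integral_sobFun h hψ
  have h0 : ∫ t in Ω, φ.normed volume (x - t) * sobFun (0 : SobolevW p Ω) t = 0 := by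
    rw [integral_congr_ae (g := fun _ => (0 : ℝ)), integral_zero]
    filter_upwards [Lp.coeFn_zero ℝ p (lebOn Ω)] with t ht
    have : sobFun (0 : SobolevW p Ω) t = 0 := ht
    rw [this, mul_zero]
  rw [h0] at key
  refine key.congr fun n => ?_
  rw [mollify, ← integral_indicator hΩ]
  congr 1; ext t
  by_cases ht : t ∈ Ω <;> simp [ht, mul_comm]

/-- Weak convergence in a Sobolev space implies almost everywhere convergence of a subsequence. -/
theorem exists_subseq_ae_sobFun (hΩ : IsOpen Ω) {u : ℕ → SobolevW p Ω} {w : SobolevW p Ω}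
    (h : WeaklyConvergesTo u w) :
    ∃ s : ℕ → ℕ, StrictMono s ∧
      ∀ᵐ x ∂(lebOn Ω), Tendsto (fun n => sobFun (u (s n)) x) atTop (𝓝 (sobFun w x)) := by
  have hz := h.sub_self
  obtain ⟨M, hM⟩ := hz.exists_norm_le
  have hMe : ∀ n, ‖u n - w‖ₑ ≤ ENNReal.ofReal M := fun n => by
    rw [← ofReal_norm]; exact ENNReal.ofReal_le_ofReal (hM n)
  have hloc : ∀ x₀ ∈ Ω, ∃ r > 0, Tendsto (fun n => ∫⁻ x in Metric.ball x₀ r,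
      ‖Ω.indicator (sobFun (u n - w)) x‖ₑ) atTop (𝓝 0) := by
    intro x₀ hx₀
    obtain ⟨R, hR0, hR⟩ := Metric.isOpen_iff.1 hΩ x₀ hx₀
    refine ⟨R / 2, by positivity, ?_⟩
    refine tendsto_lintegral_ball_of_weak hΩ.measurableSet
      (fun n => locallyIntegrable_indicator_sobFun hΩ.measurableSet (u n - w))
      (fun n => (stronglyMeasurable_sobFun _).measurable)
      (fun n => (stronglyMeasurable_sobGrad _).measurable) (fun n => (u n - w).2)
      (half_lt_self hR0) hR
      (M := ENNReal.ofReal M * volume (Metric.ball x₀ R) ^ (1 - 1 / p.toReal)) ?_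
      (fun n => ?_) (fun n => ?_)
      (fun φ x => tendsto_mollify_of_weak hΩ.measurableSet hz φ x)
    · refine ENNReal.mul_ne_top ENNReal.ofReal_ne_top (ENNReal.rpow_ne_top_of_nonneg' ?_ ?_)
      · exact Metric.measure_ball_pos _ _ hR0
      · exact measure_ball_lt_top.ne
    · refine (setLIntegral_ball_le (p := p) hΩ.measurableSet
        (stronglyMeasurable_sobFun (u n - w)).aestronglyMeasurable x₀ R).trans ?_
      gcongr
      exact (eLpNorm_sobFun_le _).trans (hMe n)
    · refine (setLIntegral_ball_le (p := p) hΩ.measurableSet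
        (stronglyMeasurable_sobGrad (u n - w)).aestronglyMeasurable x₀ R).trans ?_
      gcongr
      exact (eLpNorm_sobGrad_le _).trans (hMe n)
  choose! r hr0 hr using hloc
  -- By the Lindelöf property countably many good balls cover `Ω`, so a single subsequence serves
  -- all of them.
  obtain ⟨t, htΩ, htc, hcov⟩ := TopologicalSpace.countable_cover_nhdsWithin
    (f := fun x => Metric.ball x (r x)) (s := Ω)
    (fun x hx => mem_nhdsWithin_of_mem_nhds (Metric.ball_mem_nhds x (hr0 x hx)))
  have hres : ∃ s : ℕ → ℕ, StrictMono s ∧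
      ∀ᵐ x ∂(lebOn Ω), Tendsto (fun n => sobFun (u (s n) - w) x) atTop (𝓝 0) := by
    rcases t.eq_empty_or_nonempty with rfl | hne
    · refine ⟨id, strictMono_id, ?_⟩
      have : Ω = ∅ := by simpa using hcov
      simp [this]
    obtain ⟨e, he⟩ := htc.exists_eq_range hne
    have hemem : ∀ i, e i ∈ Ω := fun i => htΩ (he ▸ mem_range_self i)
    refine exists_subseq_ae_of_setLIntegral_cover (μ := lebOn Ω) (g := fun n => sobFun (u n - w))
      (fun n => (stronglyMeasurable_sobFun (u n - w)).aestronglyMeasurable)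
      (B := fun i => Metric.ball (e i) (r (e i))) (fun i => measurableSet_ball) ?_ (fun i => ?_)
    · filter_upwards [ae_restrict_mem hΩ.measurableSet] with x hx
      have := hcov hx
      rwa [he, biUnion_range] at this
    · refine (hr (e i) (hemem i)).congr fun n => ?_
      rw [Measure.restrict_restrict measurableSet_ball, inter_comm,
        ← Measure.restrict_restrict hΩ.measurableSet, ← lintegral_indicator hΩ.measurableSet]
      congr 1; ext t
      by_cases ht : t ∈ Ω <;> simp [ht]
  obtain ⟨s, hs, hlim⟩ := hres
  refine ⟨s, hs, ?_⟩
  have hsub := ae_all_iff.2 fun n => sobFun_sub (u (s n)) w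
  filter_upwards [hlim, hsub] with x hx hx'
  have h2 := hx.add_const (sobFun w x)
  rw [zero_add] at h2
  refine h2.congr fun n => ?_
  rw [hx' n, sub_add_cancel]

end WeakConvergence

/-! ### Equiintegrable sequences and strong convergence. -/

section Equiintegrability

variable {N : ℕ} {F : Type*} [NormedAddCommGroup F] {r : ℝ} {Ω : Set (Euc N)}

theorem Equiintegrable.comp {U : ℕ → Euc N → F} (h : Equiintegrable r Ω U) (s : ℕ → ℕ) :
    Equiintegrable r Ω (fun n => U (s n)) := by
  refine ⟨fun n => h.1 (s n), fun ε hε => ?_, fun ε hε => ?_⟩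
  · obtain ⟨δ, hδ, H⟩ := h.2.1 ε hε
    exact ⟨δ, hδ, fun n => H (s n)⟩
  · obtain ⟨R, H⟩ := h.2.2 ε hε
    exact ⟨R, fun n => H (s n)⟩

theorem Equiintegrable.lUnif {U : ℕ → Euc N → F} (h : Equiintegrable r Ω U)
    (hΩ : MeasurableSet Ω) : LUnif (lebOn Ω) (fun n x => ‖U n x‖ₑ ^ r) := by
  intro ε hε
  obtain ⟨δ, hδ, H⟩ := h.2.1 ε hε
  refine ⟨δ, hδ, fun n A hA hm => ?_⟩
  rw [Measure.restrict_apply hA] at hm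
  rw [Measure.restrict_restrict hA]
  exact H n _ (hA.inter hΩ) inter_subset_right hm

theorem Equiintegrable.lTight {U : ℕ → Euc N → F} (h : Equiintegrable r Ω U) :
    LTight (lebOn Ω) (fun n x => ‖U n x‖ₑ ^ r) := by
  intro ε hε
  obtain ⟨R, H⟩ := h.2.2 ε hε
  refine ⟨Metric.ball 0 R, measurableSet_ball,
    ne_top_of_le_ne_top measure_ball_lt_top.ne (Measure.restrict_apply_le _ _), fun n => ?_⟩
  rw [Measure.restrict_restrict measurableSet_ball.compl, inter_comm, ← sdiff_eq]
  exact H n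

theorem lintegral_rpow_enorm_ne_top {X : Type*} [MeasurableSpace X] {μ : Measure X} (hr : 0 < r)
    {f : X → F} (hf : MemLp f (ENNReal.ofReal r) μ) : ∫⁻ x, ‖f x‖ₑ ^ r ∂μ ≠ ⊤ := by
  have := lintegral_rpow_enorm_lt_top_of_eLpNorm_lt_top (by simpa using hr) (by simp) hf.2
  rwa [ENNReal.toReal_ofReal hr.le, lt_top_iff_ne_top] at this

theorem Equiintegrable.aemeasurable {U : ℕ → Euc N → F} (h : Equiintegrable r Ω U) (n : ℕ) :
    AEMeasurable (fun x => ‖U n x‖ₑ ^ r) (lebOn Ω) :=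
  (h.1 n).1.enorm.pow_const _

/-- Almost everywhere convergence of an equiintegrable sequence implies strong convergence. -/
theorem Equiintegrable.tendstoLr {U : ℕ → Euc N → F} (h : Equiintegrable r Ω U)
    (hΩ : MeasurableSet Ω) (hr : 1 ≤ r) {V : Euc N → F}
    (hV : MemLp V (ENNReal.ofReal r) (lebOn Ω))
    (hlim : ∀ᵐ x ∂(lebOn Ω), Tendsto (fun n => U n x) atTop (𝓝 (V x))) :
    Tendsto (fun n => eLpNorm (fun x => U n x - V x) (ENNReal.ofReal r) (lebOn Ω)) atTop (𝓝 0) := by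
  have hr0 : 0 < r := by linarith
  have hVi := lintegral_rpow_enorm_ne_top hr0 hV
  have hle : ∀ n x, ‖U n x - V x‖ₑ ^ r ≤ (2 : ℝ≥0∞) ^ (r - 1) * (‖U n x‖ₑ ^ r + ‖V x‖ₑ ^ r) := by
    intro n x
    refine le_trans ?_ (ENNReal.rpow_add_le_mul_rpow_add_rpow _ _ hr)
    exact ENNReal.rpow_le_rpow enorm_sub_le hr0.le
  have hc : (2 : ℝ≥0∞) ^ (r - 1) ≠ ⊤ := by simp
  have key : Tendsto (fun n => ∫⁻ x, ‖U n x - V x‖ₑ ^ r ∂(lebOn Ω)) atTop (𝓝 0) := by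
    refine tendsto_lintegral_zero_of_ae
      (fun n => ((h.1 n).1.sub hV.1).enorm.pow_const _) ?_ ?_ ?_
    · exact (((h.lUnif hΩ).add (lUnif_of_integrable hVi) h.aemeasurable).const_mul hc).mono
        fun n => ae_of_all _ fun x => hle n x
    · exact ((h.lTight.add (lTight_of_integrable hVi) h.aemeasurable).const_mul hc).mono
        fun n => ae_of_all _ fun x => hle n x
    · filter_upwards [hlim] with x hx
      have h1 : Tendsto (fun n => ‖U n x - V x‖ₑ) atTop (𝓝 0) := by
        simpa using (hx.sub_const (V x)).enorm
      have h2 := (ENNReal.continuous_rpow_const (y := r)).tendsto 0 |>.comp h1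
      rwa [ENNReal.zero_rpow_of_pos hr0] at h2
  have e : ∀ n, eLpNorm (fun x => U n x - V x) (ENNReal.ofReal r) (lebOn Ω) =
      (∫⁻ x, ‖U n x - V x‖ₑ ^ r ∂(lebOn Ω)) ^ (1 / r) := by
    intro n
    rw [eLpNorm_eq_lintegral_rpow_enorm_toReal (by simpa using hr0) (by simp),
      ENNReal.toReal_ofReal hr0.le]
  simp_rw [e]
  have h2 := (ENNReal.continuous_rpow_const (y := 1 / r)).tendsto 0 |>.comp key
  rwa [ENNReal.zero_rpow_of_pos (by positivity)] at h2

theorem le_one_add_rpow (a : ℝ≥0∞) {r : ℝ} (hr : 1 ≤ r) : a ≤ 1 + a ^ r := by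
  rcases le_total a 1 with h | h
  · exact h.trans le_self_add
  · calc a = a ^ (1 : ℝ) := (ENNReal.rpow_one a).symm
      _ ≤ a ^ r := ENNReal.rpow_le_rpow_of_exponent_le h hr
      _ ≤ 1 + a ^ r := le_add_self

/-- An `r`-equiintegrable sequence is uniformly integrable. -/
theorem Equiintegrable.lUnif_enorm {U : ℕ → Euc N → F} (h : Equiintegrable r Ω U)
    (hΩ : MeasurableSet Ω) (hr : 1 ≤ r) : LUnif (lebOn Ω) (fun n x => ‖U n x‖ₑ) :=
  (((lUnif_const ENNReal.one_ne_top).add (h.lUnif hΩ) fun _ => aemeasurable_const).mono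
    fun _ => ae_of_all _ fun _ => le_one_add_rpow _ hr)

theorem lUnif_enorm_of_memLp {V : Euc N → F} (hr : 1 ≤ r)
    (hV : MemLp V (ENNReal.ofReal r) (lebOn Ω)) : LUnif (lebOn Ω) (fun _ x => ‖V x‖ₑ) :=
  (((lUnif_const ENNReal.one_ne_top).add
    (lUnif_of_integrable (lintegral_rpow_enorm_ne_top (by linarith) hV))
    fun _ => aemeasurable_const).mono fun _ => ae_of_all _ fun _ => le_one_add_rpow _ hr)

/-- Strong convergence in `L^r(Ω)` implies convergence in `L¹` on sets of finite measure. -/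
theorem tendsto_eLpNorm_one_of_eLpNorm (hr : 1 ≤ r) {f : ℕ → Euc N → F}
    (hf : ∀ n, AEStronglyMeasurable (f n) (lebOn Ω))
    (h : Tendsto (fun n => eLpNorm (f n) (ENNReal.ofReal r) (lebOn Ω)) atTop (𝓝 0))
    {K : Set (Euc N)} (hK : volume K ≠ ⊤) (hKΩ : K ⊆ Ω) :
    Tendsto (fun n => eLpNorm (f n) 1 (lebOn K)) atTop (𝓝 0) := by
  have hm : lebOn K ≤ lebOn Ω := Measure.restrict_mono_set _ hKΩ
  set c := volume K ^ (1 - 1 / r) with hc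
  have hctop : c ≠ ⊤ := by
    refine ENNReal.rpow_ne_top_of_nonneg ?_ hK
    rw [sub_nonneg]
    exact (div_le_one (by linarith)).2 hr
  have hlim : Tendsto (fun n => eLpNorm (f n) (ENNReal.ofReal r) (lebOn Ω) * c) atTop (𝓝 0) := by
    simpa using ENNReal.Tendsto.mul_const h (Or.inr hctop)
  refine tendsto_of_tendsto_of_tendsto_of_le_of_le tendsto_const_nhds hlim (fun n => zero_le)
    fun n => ?_
  have h1 : (1 : ℝ≥0∞) ≤ ENNReal.ofReal r := by simpa using hr
  have h2 := eLpNorm_le_eLpNorm_mul_rpow_measure_univ h1 ((hf n).mono_measure hm)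
  rw [Measure.restrict_apply_univ, ENNReal.toReal_one, div_one,
    ENNReal.toReal_ofReal (by linarith)] at h2
  exact h2.trans (mul_le_mul' (eLpNorm_mono_measure _ hm) le_rfl)

end Equiintegrability

/-! ### The integral functional along a.e. convergent sequences. -/

section Energy

variable {N : ℕ} {p q : ℝ} {Ω : Set (Euc N)} {j : Euc N → ℝ → Euc N → ℝ}

theorem IsCriticalExponent.lt [hp : Fact (1 < p)] (hq : IsCriticalExponent N p q) : p < q := by
  unfold IsCriticalExponent at hq
  have h1 := hp.out
  split_ifs at hq with h
  · rw [hq, lt_div_iff₀ (by linarith)]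
    nlinarith
  · exact hq

theorem SobolevEmbeds.memLp {P Q : ℝ≥0∞} [Fact (1 ≤ P)] (h : SobolevEmbeds P Ω Q)
    (w : SobolevW P Ω) : MemLp (sobFun w) Q (lebOn Ω) := by
  obtain ⟨K, hK⟩ := h
  exact ⟨(stronglyMeasurable_sobFun w).aestronglyMeasurable,
    (hK w).trans_lt (ENNReal.mul_lt_top ENNReal.coe_lt_top enorm_lt_top)⟩

theorem IsCaratheodoryIntegrand.aemeasurable_comp (hj : IsCaratheodoryIntegrand Ω j)
    {v : Euc N → ℝ} {G : Euc N → Euc N} (hv : StronglyMeasurable v) (hG : StronglyMeasurable G) :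
    AEMeasurable (fun x => j x (v x) (G x)) (lebOn Ω) :=
  aemeasurable_caratheodory (g := fun x (z : ℝ × Euc N) => j x z.1 z.2)
    (fun z => hj.1 z.1 z.2) hj.2 (hv.prodMk hG)

/-- Majorant of the negative part of the integrand. -/
noncomputable def negMajorant (p q C : ℝ) (h : Euc N → ℝ) (v : Euc N → ℝ) (G : Euc N → Euc N)
    (x : Euc N) : ℝ≥0∞ :=
  ENNReal.ofReal C * (‖G x‖ₑ ^ p + (‖v x‖ₑ ^ q + ‖v x‖ₑ ^ p)) + ‖h x‖ₑ

theorem ofReal_neg_le_negMajorant {C : ℝ} (hC : 0 ≤ C) (hp0 : 0 ≤ p) (hq0 : 0 ≤ q)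
    {h : Euc N → ℝ} {v : Euc N → ℝ} {G : Euc N → Euc N} {x : Euc N}
    (hlow : ∀ (μ : ℝ) (ξ : Euc N), j x μ ξ ≥ -C * (‖ξ‖ ^ p + |μ| ^ q + |μ| ^ p) - |h x|) :
    ENNReal.ofReal (-(j x (v x) (G x))) ≤ negMajorant p q C h v G x := by
  have h1 := hlow (v x) (G x)
  have e1 : 0 ≤ ‖G x‖ ^ p := by positivity
  have e2 : 0 ≤ ‖v x‖ ^ q := by positivity
  have e3 : 0 ≤ ‖v x‖ ^ p := by positivity
  unfold negMajorant
  rw [← ofReal_norm, ← ofReal_norm, ← ofReal_norm, ENNReal.ofReal_rpow_of_nonneg (norm_nonneg _) hp0,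
    ENNReal.ofReal_rpow_of_nonneg (norm_nonneg _) hp0,
    ENNReal.ofReal_rpow_of_nonneg (norm_nonneg _) hq0, ← ENNReal.ofReal_add e2 e3,
    ← ENNReal.ofReal_add e1 (by positivity), ← ENNReal.ofReal_mul hC,
    ← ENNReal.ofReal_add (by positivity) (norm_nonneg _)]
  refine ENNReal.ofReal_le_ofReal ?_
  simp only [Real.norm_eq_abs (v x), Real.norm_eq_abs (h x)]
  linarith

theorem lintegral_negMajorant_ne_top {C : ℝ} {h : Euc N → ℝ} (hh : IntegrableOn h Ω)
    {v : Euc N → ℝ} {G : Euc N → Euc N} (hp0 : 0 < p) (hq0 : 0 < q)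
    (hv : MemLp v (ENNReal.ofReal p) (lebOn Ω)) (hv' : MemLp v (ENNReal.ofReal q) (lebOn Ω))
    (hG : MemLp G (ENNReal.ofReal p) (lebOn Ω)) :
    ∫⁻ x in Ω, negMajorant p q C h v G x ≠ ⊤ := by
  unfold negMajorant
  rw [lintegral_add_right' _ hh.1.enorm, lintegral_const_mul' _ _ ENNReal.ofReal_ne_top,
    lintegral_add_left' (hG.1.enorm.pow_const _), lintegral_add_left' (hv'.1.enorm.pow_const _)]
  refine ENNReal.add_ne_top.2 ⟨ENNReal.mul_ne_top ENNReal.ofReal_ne_top (ENNReal.add_ne_top.2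
    ⟨lintegral_rpow_enorm_ne_top hp0 hG, ENNReal.add_ne_top.2
      ⟨lintegral_rpow_enorm_ne_top hq0 hv', lintegral_rpow_enorm_ne_top hp0 hv⟩⟩), hh.2.ne⟩

variable {C : ℝ} {h : Euc N → ℝ}

/-- The embedding supplies the integrability of the power `q` in the lower bound, so the energy of
every Sobolev function is well defined and not `⊥`. -/
theorem lintegral_neg_energy_ne_top [hp : Fact (1 < p)] (hq : IsCriticalExponent N p q)
    (hemb : SobolevEmbeds (ENNReal.ofReal p) Ω (ENNReal.ofReal q)) (hC : 0 < C)
    (hh : IntegrableOn h Ω)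
    (hlow : ∀ᵐ x ∂(lebOn Ω), ∀ (μ : ℝ) (ξ : Euc N),
      j x μ ξ ≥ -C * (‖ξ‖ ^ p + |μ| ^ q + |μ| ^ p) - |h x|)
    (w : SobolevW (ENNReal.ofReal p) Ω) :
    ∫⁻ x in Ω, ENNReal.ofReal (-(j x (sobFun w x) (sobGrad w x))) ≠ ⊤ := by
  have h1 := hp.out
  have h2 := hq.lt
  refine ne_top_of_le_ne_top (lintegral_negMajorant_ne_top (C := C) hh (by linarith) (by linarith)
    (memLp_sobFun w) (hemb.memLp w) (memLp_sobGrad w)) (lintegral_mono_ae ?_)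
  filter_upwards [hlow] with x hx
  exact ofReal_neg_le_negMajorant hC.le (by linarith) (by linarith) hx

theorem extInt_congr {X : Type*} [MeasurableSpace X] {μ : Measure X} {f g : X → ℝ}
    (hfg : f =ᵐ[μ] g) : extInt μ f = extInt μ g := by
  unfold extInt
  rw [lintegral_congr_ae (g := fun x => ENNReal.ofReal (g x))
    (by filter_upwards [hfg] with x hx; rw [hx]),
    lintegral_congr_ae (f := fun x => ENNReal.ofReal (-(f x)))
      (g := fun x => ENNReal.ofReal (-(g x)))
    (by filter_upwards [hfg] with x hx; rw [hx])]

/-- Measurable selection of a subgradient of `j(x, v(x), ·)` at `G(x)`. -/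
theorem IsCaratheodoryIntegrand.exists_subgradient (hj : IsCaratheodoryIntegrand Ω j)
    (hconv : ∀ᵐ x ∂(lebOn Ω), ∀ μ : ℝ, StrictConvexOn ℝ univ (fun ξ : Euc N => j x μ ξ))
    {v : Euc N → ℝ} {G : Euc N → Euc N} (hv : StronglyMeasurable v) (hG : StronglyMeasurable G) :
    ∃ ξ : Euc N → Euc N, Measurable ξ ∧ ∀ᵐ x ∂(lebOn Ω), ∀ η,
      j x (v x) (G x) + inner ℝ (ξ x) (η - G x) ≤ j x (v x) η := by
  have hc : ∀ᵐ x ∂(lebOn Ω),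
      ConvexOn ℝ univ (fun η => j x (v x) (G x + η) - j x (v x) (G x)) := by
    filter_upwards [hconv] with x hx
    have h1 := (hx (v x)).convexOn.translate_right (G x)
    rw [preimage_univ] at h1
    exact (h1.add_const (-(j x (v x) (G x)))).congr fun η _ => by simp [sub_eq_add_neg]
  obtain ⟨ξ, hξ, hsub⟩ := exists_measurable_subgradient
    (fun η => (hj.aemeasurable_comp hv (hG.add stronglyMeasurable_const)).sub
      (hj.aemeasurable_comp hv hG)) hc (ae_of_all _ fun x => by simp)
  refine ⟨ξ, hξ, ?_⟩
  filter_upwards [hsub] with x hx η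
  have := hx (η - G x)
  simp only [Pi.sub_apply, Pi.add_apply, add_sub_cancel] at this
  linarith

/-- Lower semicontinuity and compactness along almost everywhere convergent sequences. -/
theorem energy_of_ae [hp : Fact (1 < p)] (hq : IsCriticalExponent N p q) (hΩ : IsOpen Ω)
    (hemb : SobolevEmbeds (ENNReal.ofReal p) Ω (ENNReal.ofReal q))
    (hj : IsCaratheodoryIntegrand Ω j) (hC : 0 < C) (hh : IntegrableOn h Ω)
    (hlow : ∀ᵐ x ∂(lebOn Ω), ∀ (μ : ℝ) (ξ : Euc N),
      j x μ ξ ≥ -C * (‖ξ‖ ^ p + |μ| ^ q + |μ| ^ p) - |h x|)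
    (hconv : ∀ᵐ x ∂(lebOn Ω), ∀ μ : ℝ, StrictConvexOn ℝ univ (fun ξ : Euc N => j x μ ξ))
    {u : ℕ → SobolevW (ENNReal.ofReal p) Ω} {w : SobolevW (ENNReal.ofReal p) Ω}
    (hw : WeaklyConvergesTo u w)
    (hup : Equiintegrable p Ω (fun n => sobFun (u n)))
    (huq : Equiintegrable q Ω (fun n => sobFun (u n)))
    (hgp : Equiintegrable p Ω (fun n => sobGrad (u n)))
    (hae : ∀ᵐ x ∂(lebOn Ω), Tendsto (fun n => sobFun (u n) x) atTop (𝓝 (sobFun w x))) :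
    energyJ j w ≤ liminf (fun n => energyJ j (u n)) atTop ∧
      (limsup (fun n => energyJ j (u n)) atTop ≤ energyJ j w → energyJ j w < ⊤ →
        ∃ s : ℕ → ℕ, StrictMono s ∧ ∀ᵐ x ∂(lebOn Ω),
          Tendsto (fun n => sobGrad (u (s n)) x) atTop (𝓝 (sobGrad w x))) := by
  have h1 := hp.out
  have h2 := hq.lt
  have hp0 : 0 < p := by linarith
  have hq0 : 0 < q := by linarith
  have hΩm := hΩ.measurableSet
  have hf0 := hj.aemeasurable_comp (stronglyMeasurable_sobFun w) (stronglyMeasurable_sobGrad w)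
  -- A genuinely measurable representative is taken, since the exhaustion is cut out by sublevel
  -- sets of `|f|`.
  obtain ⟨f, hfm, hfe⟩ := hf0
  obtain ⟨ξ, hξm, hξ⟩ := hj.exists_subgradient hconv (stronglyMeasurable_sobFun w)
    (stronglyMeasurable_sobGrad w)
  have hDm : ∀ n, StronglyMeasurable fun x => sobGrad (u n) x - sobGrad w x := fun n =>
    (stronglyMeasurable_sobGrad (u n)).sub (stronglyMeasurable_sobGrad w)
  have hHm1 := fun n => (hup.aemeasurable n)
  have hHm2 := fun n => (huq.aemeasurable n)
  have hHm3 := fun n => (hgp.aemeasurable n)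
  have hmin : AsympMinorant (lebOn Ω) f (fun n x => j x (sobFun (u n) x) (sobGrad (u n) x))
      (fun n x => inner ℝ (ξ x) (sobGrad (u n) x - sobGrad w x)) (fun x => ‖ξ x‖)
      (fun n x => ‖sobGrad (u n) x - sobGrad w x‖ₑ)
      (fun n => negMajorant p q C h (sobFun (u n)) (sobGrad (u n))) := by
    refine ⟨hfm, ?_, fun n => hj.aemeasurable_comp (stronglyMeasurable_sobFun _)
      (stronglyMeasurable_sobGrad _), fun n => ?_, hξm.norm, fun n => (hDm n).measurable.enorm.aemeasurable,
      fun n => ?_, ?_, ?_, ?_, fun n => ?_, fun n => ?_, fun n A hA hfA hM => ?_, fun A hA hfA hM => ?_, ?_⟩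
    · have := lintegral_neg_energy_ne_top hq hemb hC hh hlow w
      rwa [lintegral_congr_ae (g := fun x => ENNReal.ofReal (-(f x)))
        (by filter_upwards [hfe] with x hx; rw [hx])] at this
    · exact (hξm.inner (hDm n).measurable).aemeasurable
    · exact ((((hHm3 n).add ((hHm2 n).add (hHm1 n))).const_mul _).add hh.1.enorm)
    · refine LUnif.mono ((hgp.lUnif_enorm hΩm h1.le).add
        (lUnif_enorm_of_memLp h1.le (memLp_sobGrad w))
        fun n => (stronglyMeasurable_sobGrad (u n)).measurable.enorm.aemeasurable)
        fun n => ae_of_all _ fun x => enorm_sub_le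
    · exact (((hgp.lUnif hΩm).add ((huq.lUnif hΩm).add (hup.lUnif hΩm) hHm2) hHm3).const_mul
        ENNReal.ofReal_ne_top).add (lUnif_of_integrable hh.2.ne)
        fun n => ((hHm3 n).add ((hHm2 n).add (hHm1 n))).const_mul _
    · exact ((hgp.lTight.add (huq.lTight.add hup.lTight hHm2) hHm3).const_mul
        ENNReal.ofReal_ne_top).add (lTight_of_integrable hh.2.ne)
        fun n => ((hHm3 n).add ((hHm2 n).add (hHm1 n))).const_mul _
    · filter_upwards [hlow] with x hx
      exact ofReal_neg_le_negMajorant hC.le hp0.le hq0.le hx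
    · refine ae_of_all _ fun x => ?_
      rw [← ofReal_norm, ← ofReal_norm, ← ENNReal.ofReal_mul (norm_nonneg _)]
      exact ENNReal.ofReal_le_ofReal (norm_inner_le_norm _ _)
    · obtain ⟨M, hM⟩ := hM
      have : IsFiniteMeasure ((lebOn Ω).restrict A) := ⟨by simpa using hfA.lt_top⟩
      have hi : Integrable (fun x => sobGrad (u n) x - sobGrad w x) ((lebOn Ω).restrict A) :=
        (((memLp_sobGrad (u n)).sub (memLp_sobGrad w)).restrict A).integrable Fact.out
      refine (hi.norm.const_mul M).mono' (hξm.inner (hDm n).measurable).aestronglyMeasurable ?_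
      filter_upwards [ae_restrict_mem hA] with x hx
      exact (norm_inner_le_norm _ _).trans (by gcongr; exact hM x hx)
    · obtain ⟨M, hM⟩ := hM
      -- No integrability of `ξ` is known globally; cut off to a set of finite measure where it is
      -- bounded, it becomes an admissible test function for the weak convergence.
      have hψ : MemLp (A.indicator ξ) (ENNReal.ofReal p).conjExponent (lebOn Ω) := by
        refine memLp_of_bounded_support (hξm.indicator hA).aestronglyMeasurable hA hfA
          (M := max M 0) (fun x => ?_) (fun x hx => indicator_of_notMem hx _) _
        by_cases hx : x ∈ A
        · rw [indicator_of_mem hx]; exact (hM x hx).trans (le_max_left _ _)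
        · rw [indicator_of_notMem hx]; simp
      have hlim := (tendsto_integral_sobGrad hw hψ).sub_const
        (∫ x in Ω, inner ℝ (A.indicator ξ x) (sobGrad w x))
      rw [sub_self] at hlim
      refine hlim.congr fun n => ?_
      have hint : ∀ z : SobolevW (ENNReal.ofReal p) Ω,
          Integrable (fun x => inner ℝ (A.indicator ξ x) (sobGrad z x)) (lebOn Ω) := fun z => by
        have : ENNReal.HolderTriple (ENNReal.ofReal p).conjExponent (ENNReal.ofReal p) 1 :=
          inferInstance
        exact memLp_one_iff_integrable.1 ((innerSL ℝ (E := Euc N)).memLp_of_bilin 1 hψ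
          (memLp_sobGrad z))
      rw [← integral_sub (hint (u n)) (hint w), ← integral_indicator hA]
      refine integral_congr_ae (ae_of_all _ fun x => ?_)
      by_cases hx : x ∈ A
      · simp [hx, inner_sub_right]
      · simp [hx]
    · filter_upwards [hae, hconv, hj.2, hξ, hfe] with x hx1 hx2 hx3 hx4 hx5 κ hκ
      -- The bound holds for all `η` at once, so it may be evaluated at the gradient of `u n`, about
      -- whose pointwise behaviour nothing is known.
      have := hx1.eventually (eventually_sub_le hx3 hx2 hx4 hκ)
      filter_upwards [this] with n hn
      rw [← hx5]
      exact hn _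
  have hfin : ∀ n, ∫⁻ x, negMajorant p q C h (sobFun (u n)) (sobGrad (u n)) x ∂(lebOn Ω) ≠ ⊤ :=
    fun n => lintegral_negMajorant_ne_top hh hp0 hq0 (memLp_sobFun _) (huq.1 n) (memLp_sobGrad _)
  have hJw : energyJ j w = extInt (lebOn Ω) f := extInt_congr hfe
  rw [hJw]
  refine ⟨hmin.extInt_le_liminf hfin, fun hls hlt => ?_⟩
  obtain ⟨A, hA, hmono, hun, hlim⟩ := hmin.tendsto_defect_of_limsup_le hfin hls hlt
  obtain ⟨s, hs, hs'⟩ := exists_subseq_ae_of_setLIntegral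
    (fun n => (((hmin.meas_fn n).sub hfm.aemeasurable).sub (hmin.meas_b n)).aestronglyMeasurable)
    hA hmono (ae_of_all _ fun x => by rw [hun]; trivial) hlim
  refine ⟨s, hs, ?_⟩
  filter_upwards [hae, hconv, hj.2, hξ, hfe, hs'] with x hx1 hx2 hx3 hx4 hx5 hx6
  rw [Metric.tendsto_nhds]
  intro ε hε
  -- A gradient at distance at least `ε` from the limit would make the defect at least `c`, against
  -- its convergence to zero.
  obtain ⟨c, hc, hev⟩ := eventually_add_const_le hx3 hx2 hx4 hε
  filter_upwards [(hx1.comp hs.tendsto_atTop).eventually hev, hx6.eventually_lt_const hc]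
    with n hn1 hn2
  rw [dist_eq_norm]
  by_contra hcon
  have := hn1 _ (not_lt.1 hcon)
  simp only [Pi.sub_apply, Function.comp] at hn2 this
  rw [hx5] at this
  linarith

end Energy

/-! ### The theorem, by removal of the subsequences. -/

theorem theorem2p5 {N : ℕ} (hN : 0 < N) (p q : ℝ) [Fact (1 < p)]
    (hq : IsCriticalExponent N p q)
    (Ω : Set (Euc N)) (hΩ : IsOpen Ω)
    (hemb : SobolevEmbeds (ENNReal.ofReal p) Ω (ENNReal.ofReal q))
    (j : Euc N → ℝ → Euc N → ℝ) (hj : IsCaratheodoryIntegrand Ω j)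
    (C : ℝ) (hC : 0 < C) (h : Euc N → ℝ) (hh : IntegrableOn h Ω)
    (hlow : ∀ᵐ x ∂(lebOn Ω), ∀ (μ : ℝ) (ξ : Euc N),
      j x μ ξ ≥ -C * (‖ξ‖ ^ p + |μ| ^ q + |μ| ^ p) - |h x|)
    (hconv : ∀ᵐ x ∂(lebOn Ω), ∀ μ : ℝ, StrictConvexOn ℝ univ (fun ξ : Euc N => j x μ ξ)) :
    (∀ w : SobolevW (ENNReal.ofReal p) Ω,
      AEMeasurable (fun x => j x (sobFun w x) (sobGrad w x)) (lebOn Ω) ∧ energyJ j w ≠ ⊥) ∧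
    ∀ (u : ℕ → SobolevW (ENNReal.ofReal p) Ω) (w : SobolevW (ENNReal.ofReal p) Ω),
      WeaklyConvergesTo u w →
      Equiintegrable p Ω (fun n => sobFun (u n)) →
      Equiintegrable q Ω (fun n => sobFun (u n)) →
      Equiintegrable p Ω (fun n => sobGrad (u n)) →
      energyJ j w ≤ liminf (fun n => energyJ j (u n)) atTop ∧
      (limsup (fun n => energyJ j (u n)) atTop ≤ energyJ j w → energyJ j w < ⊤ →
        TendstoW11Loc u w ∧
        TendstoLr p Ω (fun n => sobGrad (u n)) (sobGrad w) ∧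
        TendstoLr p Ω (fun n => sobFun (u n)) (sobFun w) ∧
        TendstoLr q Ω (fun n => sobFun (u n)) (sobFun w)) := by
  have h1p : 1 < p := Fact.out
  have hpq := hq.lt
  have hΩm := hΩ.measurableSet
  refine ⟨fun w => ⟨hj.aemeasurable_comp (stronglyMeasurable_sobFun w)
    (stronglyMeasurable_sobGrad w),
    extInt_ne_bot (lintegral_neg_energy_ne_top hq hemb hC hh hlow w)⟩,
    fun u w hw hup huq hgp => ⟨?_, fun hls hlt => ?_⟩⟩
  · by_contra hcon
    -- Energies below `b` are fixed along a subsequence before a.e. convergence is extracted, so the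
    -- further extraction keeps the contradiction.
    obtain ⟨b, hb1, hb2⟩ := exists_between (not_le.1 hcon)
    obtain ⟨s, hs, hsb⟩ := extraction_of_frequently_atTop
      (frequently_lt_of_liminf_lt (by isBoundedDefault) hb1)
    obtain ⟨t, ht, hae⟩ := exists_subseq_ae_sobFun hΩ (hw.comp hs.tendsto_atTop)
    have hst := hs.tendsto_atTop.comp ht.tendsto_atTop
    have key := (energy_of_ae hq hΩ hemb hj hC hh hlow hconv (hw.comp hst)
      (hup.comp (s ∘ t)) (huq.comp (s ∘ t)) (hgp.comp (s ∘ t)) hae).1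
    refine absurd (key.trans (liminf_le_of_frequently_le' (Eventually.frequently ?_)))
      (not_le.2 hb2)
    exact Eventually.of_forall fun n => (hsb (t n)).le
  -- Strong convergence of the functions follows from weak convergence and equiintegrability alone;
  -- only the gradients need the energy condition.
  · have hfun : ∀ r : ℝ, 1 ≤ r → Equiintegrable r Ω (fun n => sobFun (u n)) →
        MemLp (sobFun w) (ENNReal.ofReal r) (lebOn Ω) →
        TendstoLr r Ω (fun n => sobFun (u n)) (sobFun w) := by
      intro r hr hur hwr
      refine ⟨hur.1, hwr, tendsto_of_subseq_tendsto fun ns hns => ?_⟩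
      obtain ⟨t, ht, hae⟩ := exists_subseq_ae_sobFun hΩ (hw.comp hns)
      exact ⟨t, (hur.comp (ns ∘ t)).tendstoLr hΩm hr hwr hae⟩
    have hgrad : TendstoLr p Ω (fun n => sobGrad (u n)) (sobGrad w) := by
      refine ⟨hgp.1, memLp_sobGrad w, tendsto_of_subseq_tendsto fun ns hns => ?_⟩
      obtain ⟨t, ht, hae⟩ := exists_subseq_ae_sobFun hΩ (hw.comp hns)
      have hst := hns.comp ht.tendsto_atTop
      -- The energy condition passes to every subsequence, as the subsequence principle requires.
      have hls' : limsup (fun n => energyJ j (u ((ns ∘ t) n))) atTop ≤ energyJ j w := by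
        refine le_trans ?_ hls
        have := limsup_le_limsup_of_le (β := EReal) hst (u := fun n => energyJ j (u n))
        exact this
      obtain ⟨t', ht', hae'⟩ := (energy_of_ae hq hΩ hemb hj hC hh hlow hconv (hw.comp hst)
        (hup.comp (ns ∘ t)) (huq.comp (ns ∘ t)) (hgp.comp (ns ∘ t)) hae).2 hls' hlt
      exact ⟨t ∘ t', (hgp.comp (ns ∘ t ∘ t')).tendstoLr hΩm h1p.le (memLp_sobGrad w) hae'⟩
    have hfunp := hfun p h1p.le hup (memLp_sobFun w)
    refine ⟨fun K hK hKΩ => ⟨?_, ?_⟩, hgrad, hfunp, hfun q (by linarith) huq (hemb.memLp w)⟩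
    · exact tendsto_eLpNorm_one_of_eLpNorm h1p.le (fun n => ((hup.1 n).1.sub (memLp_sobFun w).1))
        hfunp.2.2 hK.measure_lt_top.ne hKΩ
    · exact tendsto_eLpNorm_one_of_eLpNorm h1p.le (fun n => ((hgp.1 n).1.sub (memLp_sobGrad w).1))
        hgrad.2.2 hK.measure_lt_top.ne hKΩ
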